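/- Let $m,n\ge 1$, $x_0<x_1<\dots<x_m$, $y_0<y_1<\dots<y_n$, $\Omega=[x_0,x_m]\times[y_0,y_n]$, and put $x_i=x_0$ for $i<0$, $x_i=x_m$ for $i>m$, and similarly for $y_j$. Let $h_i=x_i-x_{i-1}$, $k_j=y_j-y_{j-1}$, $s_i=\frac12(x_{i-1}+x_i)$, $t_j=\frac12(y_{j-1}+y_j)$, $A_{ij}=(x_i,y_j)$, $M_{ij}=(s_i,t_j)$, $h=\max\{h_i,k_j:1\le i\le m,\,1\le j\le n\}$, $\delta=\min\{h_i,k_j:1\le i\le m,\,1\le j\le n\}$, and, for $1\le i\le m+1$ and $1\le j\le n+1$, $\sigma_i=\frac{h_i}{h_{i-1}+h_i}$, $\sigma_i'=1-\sigma_i$, $\tau_j=\frac{k_j}{k_{j-1}+k_j}$, $\tau_j'=1-\tau_j$. The criss-cross triangulation of $\Omega$ consists of the triangles $T$ obtained by drawing both diagonals in each rectangle $\Omega_{rs}=[x_{r-1},x_r]\times[y_{s-1},y_s]$, $1\le r\le m$, $1\le s\le n$. For $0\le i\le m+1$, $0\le j\le n+1$ let $B_{ij}$ be the quadratic B-spline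 on this triangulation with double knots at the ends: the $C^1$ function on $\Omega$, quadratic on each triangle, whose Bernstein–Bézier coefficient is $v_i(r)\,w_j(s)$ at $A_{rs}$, where $v_i(i-1)=\sigma_i'$, $v_i(i)=\sigma_{i+1}$, $w_j(j-1)=\tau_j'$, $w_j(j)=\tau_{j+1}$ and $v_i(r)=w_j(s)=0$ otherwise; is $\tau_j',\tau_{j+1},\sigma_i',\sigma_{i+1}$ at the midpoints of the bottom, top, left and right side of $\Omega_{ij}$ (as far as these sides are nondegenerate segments in $\Omega$); and is $0$ at the midpoints of all other sides of the rectangles $\Omega_{rs}$. Define $$S_2f=\sum_{i=0}^{m+1}\sum_{j=0}^{n+1}\mu_{ij}(f)B_{ij},\qquad W_2^*f=\sum_{i=0}^{m+1}\sum_{j=0}^{n+1}\mu^*_{ij}(f)B_{ij},$$ $$\mu_{ij}(f)=b_{ij}f(M_{ij})+a_if(M_{i-1,j})+c_if(M_{i+1,j})+\bar a_jf(M_{i,j-1})+\bar c_jf(M_{i,j+1}),$$ $$\mu^*_{ij}(f)=2f(M_{ij})-\tfrac14\big[f(A_{i-1,j-1})+f(A_{i-1,j})+f(A_{i,j-1})+f(A_{ij})\big],$$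 where $a_i=-\frac{\sigma_i^2\sigma_{i+1}'}{\sigma_i+\sigma_{i+1}'}$, $c_i=-\frac{\sigma_i(\sigma_{i+1}')^2}{\sigma_i+\sigma_{i+1}'}$ for $1\le i\le m$, $a_0=c_0=a_{m+1}=c_{m+1}=0$, $\bar a_j,\bar c_j$ are given by the same formulas with $\tau$ in place of $\sigma$ and $n$ in place of $m$, and $b_{ij}=1-(a_i+c_i+\bar a_j+\bar c_j)$. For $\alpha=(\alpha_1,\alpha_2)$ let $|\alpha|=\alpha_1+\alpha_2$ and $D^\alpha=\partial^{|\alpha|}/\partial x^{\alpha_1}\partial y^{\alpha_2}$. Let $\omega(D^2f,t)=\max_{|\alpha|=2}\sup\{|D^\alpha f(M)-D^\alpha f(P)|: M,P\in\Omega,\ \|M-P\|\le t\}$ with the Euclidean norm, and $\|D^3f\|=\max_{|\alpha|=3}\sup_\Omega|D^\alpha f|$. **Theorem.** (i) For $Q=S_2$ and for $Q=W_2^*$ there is an absolute constant $D_2>0$, with $D_2\le183$ for $Q=S_2$ and $D_2\le\frac{195}2$ for $Q=W_2^*$, such that for all partitions as above, all $f\in C^2(\Omega)$, all triangles $T$ of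 the triangulation and all $\alpha$ with $|\alpha|=2$, $Qf$ is $C^2$ in the interior of $T$ and $$\|D^\alpha f-D^\alpha Qf\|_{\mathrm{int}(T)}\le\Big[1+D_2\Big(\frac h\delta\Big)^2\Big]\,\omega(D^2f,h/2),$$ where $\|\cdot\|_{\mathrm{int}(T)}$ is the supremum norm over the interior of $T$. (ii) For $Q=S_2$ and for $Q=W_2^*$ there is an absolute constant $D_3>0$, with $D_3\le\frac{269}8$ for $Q=S_2$ and $D_3\le\frac{65}4$ for $Q=W_2^*$, such that for all partitions as above, all $f\in C^3(\Omega)$, all triangles $T$ and all $\alpha$ with $|\alpha|=2$, $$\|D^\alpha f-D^\alpha Qf\|_{\mathrm{int}(T)}\le\Big[1+D_3\Big(\frac h\delta\Big)^2\Big]\,h\,\|D^3f\|.$$ -/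

import Mathlib

namespace CrissCross

noncomputable section

/-- A partition `x_0 < x_1 < ... < x_N` (with `N ≥ 1`) of the interval `[x_0, x_N]`. -/
structure Knots where
  N : ℕ
  pos : 1 ≤ N
  pt : Fin (N + 1) → ℝ
  mono : StrictMono pt

namespace Knots

variable (K : Knots)

/-- The knot `x_i`, with repeated end knots: `x_i = x_0` for `i ≤ 0` and `x_i = x_N` for `i ≥ N`. -/
def x (i : ℤ) : ℝ := K.pt ⟨min i.toNat K.N, by omega⟩

/-- The step `h_i = x_i - x_{i-1}`; in particular `h_0 = h_{N+1} = 0`. -/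
def step (i : ℤ) : ℝ := K.x i - K.x (i - 1)

/-- `s_i = (x_{i-1} + x_i) / 2`; in particular `s_0 = x_0` and `s_{N+1} = x_N`. -/
def mid (i : ℤ) : ℝ := (K.x (i - 1) + K.x i) / 2

/-- The ratio `σ_i = h_i / (h_{i-1} + h_i)`, used for `1 ≤ i ≤ N + 1`
(so `σ_1 = 1` and `σ_{N+1} = 0`). -/
def sig (i : ℤ) : ℝ := K.step i / (K.step (i - 1) + K.step i)

/-- The ratio `σ'_i = h_{i-1} / (h_{i-1} + h_i)`, used for `1 ≤ i ≤ N + 1`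
(so `σ'_1 = 0` and `σ'_{N+1} = 1`). -/
def sig' (i : ℤ) : ℝ := K.step (i - 1) / (K.step (i - 1) + K.step i)

/-- The coefficient `a_i`, which is zero for `i = 0` and `i = N + 1`. -/
def a (i : ℤ) : ℝ :=
  if 1 ≤ i ∧ i ≤ K.N then
    -(K.sig i ^ 2 * K.sig' (i + 1)) / (K.sig i + K.sig' (i + 1)) else 0

/-- The coefficient `c_i`, which is zero for `i = 0` and `i = N + 1`. -/
def c (i : ℤ) : ℝ :=
  if 1 ≤ i ∧ i ≤ K.N then
    -(K.sig i * K.sig' (i + 1) ^ 2) / (K.sig i + K.sig' (i + 1)) else 0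

/-- The interval `[x_0, x_N]`. -/
def interval : Set ℝ := Set.Icc (K.x 0) (K.x K.N)

/-- For `t ∈ [x_0, x_N]`, the index `r ∈ {1, ..., N}` with `x_{r-1} ≤ t < x_r`
(and `r = N` for `t = x_N`): the number of knots among `x_0, ..., x_{N-1}` that are `≤ t`. -/
def col (t : ℝ) : ℤ := (((Finset.range K.N).filter (fun i : ℕ => K.x (i : ℤ) ≤ t)).card : ℤ)

/-- The value at the knot `x_r` of the univariate quadratic B-spline number `i`
(with support `[x_{i-2}, x_{i+1}]`): it is `σ'_i` at `x_{i-1}` and `σ_{i+1}` at `x_i`. -/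
def knotVal (i r : ℤ) : ℝ :=
  if r = i - 1 then K.sig' i else if r = i then K.sig (i + 1) else 0

theorem idx_nonempty : (Finset.Icc (1 : ℤ) K.N).Nonempty :=
  ⟨1, Finset.mem_Icc.mpr ⟨le_refl _, by exact_mod_cast K.pos⟩⟩

/-- The maximal step `max {h_i : 1 ≤ i ≤ N}`. -/
def maxStep : ℝ := (Finset.Icc (1 : ℤ) K.N).sup' K.idx_nonempty K.step

/-- The minimal step `min {h_i : 1 ≤ i ≤ N}`. -/
def minStep : ℝ := (Finset.Icc (1 : ℤ) K.N).inf' K.idx_nonempty K.step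

end Knots

variable (K L : Knots)

/-- The rectangle `Ω = [x_0, x_m] × [y_0, y_n]`; `K` holds the knots `x_i`, `L` the knots `y_j`. -/
def Omega : Set (ℝ × ℝ) := K.interval ×ˢ L.interval

/-- `h`, the largest step of the two partitions. -/
def hmax : ℝ := max K.maxStep L.maxStep

/-- `δ`, the smallest step of the two partitions. -/
def hmin : ℝ := min K.minStep L.minStep

/-- The vertex `A_{i,j} = (x_i, y_j)` (indices outside `0..m`, `0..n` are clamped). -/
def A (i j : ℤ) : ℝ × ℝ := (K.x i, L.x j)

/-- The point `M_{i,j} = (s_i, t_j)`. -/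
def M (i j : ℤ) : ℝ × ℝ := (K.mid i, L.mid j)

/-- The closed triangles of the criss-cross triangulation: each rectangle
`[x_{r-1}, x_r] × [y_{s-1}, y_s]` is cut into four triangles by its two diagonals. -/
def cells : Set (Set (ℝ × ℝ)) :=
  {T | ∃ r s : ℤ, 1 ≤ r ∧ r ≤ K.N ∧ 1 ≤ s ∧ s ≤ L.N ∧
    (T = convexHull ℝ {A K L (r - 1) (s - 1), A K L r (s - 1), M K L r s} ∨
     T = convexHull ℝ {A K L (r - 1) s, A K L r s, M K L r s} ∨
     T = convexHull ℝ {A K L (r - 1) (s - 1), A K L (r - 1) s, M K L r s} ∨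
     T = convexHull ℝ {A K L r (s - 1), A K L r s, M K L r s})}

/-- The quadratic Bernstein-Bézier polynomial on a triangle `P, Q, C`, in the barycentric
coordinates `l₁, l₂, l₃`; the coefficients are `p, q, c` at the vertices and `e, d₁, d₂` at the
midpoints of `PQ`, `PC`, `QC`. -/
def bernstein (p q c e d₁ d₂ l₁ l₂ l₃ : ℝ) : ℝ :=
  p * l₁ ^ 2 + q * l₂ ^ 2 + c * l₃ ^ 2 + 2 * e * l₁ * l₂ + 2 * d₁ * l₁ * l₃ + 2 * d₂ * l₂ * l₃

/-- The piecewise quadratic function on the unit square cut by its diagonals, at `(u, v)`.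
Its BB-coefficients are `sw, se, nw, ne` at the corners and `eS, eN, eW, eE` at the midpoints of
the sides. The other ones are forced by the `C¹` conditions across the diagonals: between a corner
and the center it is the average of the values on the two sides at that corner, and at the center
the average of the values on the four sides. -/
def square (sw se nw ne eS eN eW eE u v : ℝ) : ℝ :=
  let dSW := (eS + eW) / 2
  let dSE := (eS + eE) / 2
  let dNW := (eN + eW) / 2
  let dNE := (eN + eE) / 2
  let z := (eS + eN + eW + eE) / 4
  if v ≤ u then
    if u + v ≤ 1 then bernstein sw se z eS dSW dSE (1 - u - v) (u - v) (2 * v)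
    else bernstein se ne z eE dSE dNE (u - v) (u + v - 1) (2 * (1 - u))
  else
    if u + v ≤ 1 then bernstein sw nw z eW dSW dNW (1 - u - v) (v - u) (2 * u)
    else bernstein nw ne z eN dNW dNE (v - u) (u + v - 1) (2 * (1 - v))

open Classical in
/-- The `C¹` quadratic B-spline `B_{ij}`, `0 ≤ i ≤ m + 1`, `0 ≤ j ≤ n + 1`, of the criss-cross
triangulation with double end knots, in Bernstein-Bézier form on each rectangle
`[x_{r-1}, x_r] × [y_{s-1}, y_s]`.
Its BB-coefficient at `A_{r,s}` is the product of the two univariate knot values; the only sides of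
rectangles whose midpoint has a nonzero BB-coefficient are the four sides of the rectangle number
`(i, j)`: the coefficients are `τ'_j` (bottom), `τ_{j+1}` (top), `σ'_i` (left), `σ_{i+1}` (right).
For `2 ≤ i ≤ m - 1`, `2 ≤ j ≤ n - 1` this is the classical B-spline with octagonal support (the
coefficient at the center is `(σ'_i + σ_{i+1} + τ'_j + τ_{j+1}) / 4`). It is zero outside `Ω`. -/
def bspline (i j : ℤ) (p : ℝ × ℝ) : ℝ :=
  if p ∈ Omega K L then
    let r := K.col p.1
    let s := L.col p.2
    let vert : ℤ → ℤ → ℝ := fun r s => K.knotVal i r * L.knotVal j s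
    let hor : ℤ → ℤ → ℝ := fun r s => if r = i then L.knotVal j s else 0
    let ver : ℤ → ℤ → ℝ := fun r s => if s = j then K.knotVal i r else 0
    square (vert (r - 1) (s - 1)) (vert r (s - 1)) (vert (r - 1) s) (vert r s)
      (hor r (s - 1)) (hor r s) (ver (r - 1) s) (ver r s)
      ((p.1 - K.x (r - 1)) / K.step r) ((p.2 - L.x (s - 1)) / L.step s)
  else 0

/-- The coefficient functional `μ_{ij}` of `S_2`. -/
def mu (f : ℝ × ℝ → ℝ) (i j : ℤ) : ℝ :=
  (1 - (K.a i + K.c i + L.a j + L.c j)) * f (M K L i j)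
    + K.a i * f (M K L (i - 1) j) + K.c i * f (M K L (i + 1) j)
    + L.a j * f (M K L i (j - 1)) + L.c j * f (M K L i (j + 1))

/-- The coefficient functional `μ*_{ij}` of `W_2^*`. -/
def muStar (f : ℝ × ℝ → ℝ) (i j : ℤ) : ℝ :=
  2 * f (M K L i j) - 1 / 4 * (f (A K L (i - 1) (j - 1)) + f (A K L (i - 1) j)
    + f (A K L i (j - 1)) + f (A K L i j))

/-- The quasi-interpolant `S_2 f = ∑ μ_{ij}(f) B_{ij}`. -/
def S2 (f : ℝ × ℝ → ℝ) (p : ℝ × ℝ) : ℝ :=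
  ∑ i ∈ Finset.Icc (0 : ℤ) (K.N + 1), ∑ j ∈ Finset.Icc (0 : ℤ) (L.N + 1),
    mu K L f i j * bspline K L i j p

/-- The quasi-interpolant `W_2^* f = ∑ μ*_{ij}(f) B_{ij}`. -/
def W2star (f : ℝ × ℝ → ℝ) (p : ℝ × ℝ) : ℝ :=
  ∑ i ∈ Finset.Icc (0 : ℤ) (K.N + 1), ∑ j ∈ Finset.Icc (0 : ℤ) (L.N + 1),
    muStar K L f i j * bspline K L i j p

/-- The derivative within `S` in the direction `v`. -/
def partialD (S : Set (ℝ × ℝ)) (v : ℝ × ℝ) (g : ℝ × ℝ → ℝ) : ℝ × ℝ → ℝ :=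
  fun p => fderivWithin ℝ g S p v

/-- `D^α g` on `S`, for `α = (α₁, α₂)`: the partial derivative of order `α₁` in the first and `α₂`
in the second variable. -/
def D (S : Set (ℝ × ℝ)) (α : ℕ × ℕ) (g : ℝ × ℝ → ℝ) : ℝ × ℝ → ℝ :=
  (partialD S (1, 0))^[α.1] ((partialD S (0, 1))^[α.2] g)

/-- The Euclidean distance of two points of the plane. -/
def eucDist (P Q : ℝ × ℝ) : ℝ := Real.sqrt ((P.1 - Q.1) ^ 2 + (P.2 - Q.2) ^ 2)

/-- The supremum norm over `S` of a bounded function. -/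
def supNorm (S : Set (ℝ × ℝ)) (g : ℝ × ℝ → ℝ) : ℝ := sSup ((fun p => |g p|) '' S)

/-- The modulus of continuity `ω(ψ, t)` over `S` of a bounded function. -/
def modulus (S : Set (ℝ × ℝ)) (ψ : ℝ × ℝ → ℝ) (t : ℝ) : ℝ :=
  sSup {d | ∃ P ∈ S, ∃ Q ∈ S, eucDist P Q ≤ t ∧ d = |ψ P - ψ Q|}

theorem antidiagonal_nonempty (s : ℕ) : (Finset.HasAntidiagonal.antidiagonal s).Nonempty :=
  ⟨(s, 0), by simp⟩

/-- `ω(D^s f, t) = max {ω(D^α f, t) : |α| = s}`. -/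
def modulusD (S : Set (ℝ × ℝ)) (s : ℕ) (f : ℝ × ℝ → ℝ) (t : ℝ) : ℝ :=
  (Finset.HasAntidiagonal.antidiagonal s).sup' (antidiagonal_nonempty s) (fun α => modulus S (D S α f) t)

/-- `‖D^s f‖ = max {‖D^α f‖ : |α| = s}`, with supremum norms over `S`. -/
def normD (S : Set (ℝ × ℝ)) (s : ℕ) (f : ℝ × ℝ → ℝ) : ℝ :=
  (Finset.HasAntidiagonal.antidiagonal s).sup' (antidiagonal_nonempty s) (fun α => supNorm S (D S α f))

/-- `‖D^α f - D^α g‖_{int T} ≤ C`, including the existence and continuity of the second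
derivatives of `g` in the interior of `T`; `f` is differentiated within `Ω`. -/
def SecondDerivError (f g : ℝ × ℝ → ℝ) (T : Set (ℝ × ℝ)) (α : ℕ × ℕ) (C : ℝ) : Prop :=
  ContDiffOn ℝ 2 g (interior T) ∧
    ∀ P ∈ interior T, |D (Omega K L) α f P - D (interior T) α g P| ≤ C

end

end CrissCross

open CrissCross

/-! Both operators reproduce quadratic polynomials: each coefficient functional sends a quadratic to
its blossom at (x_{i-1}, x_i; y_{j-1}, y_j) (`mu_quad`, `muStar_quad`), and a spline with blossom
coefficients has the Bernstein-Bézier coefficients of that quadratic (`corner_eq`, `horEdge_eq`,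
`verEdge_eq`).

Fix a triangle T and let E be the midpoint of the rectangle side on which T stands. Write f = q + g,
with q the Taylor polynomial of degree two at E. On T the second derivatives of Qf differ from those
of q by second differences of the BB-coefficients of Qg, divided by products of two steps. These
coefficients are convex combinations of functionals ν_{ij}(g), and every ν_{ij} that matters on T
has M_{ij} within ℓ¹ distance 3h/2 of E. A bound B on them therefore costs at most 12 B / δ²
(`CellEstimate`).

The operators enter only through B. Both functionals are g(M_{ij}) minus h²-scaled second
differences along the axes. The weights a_i, c_i are exactly those of a second divided difference,
so no mesh ratio appears, and B = h² (11a/8 + 19bh/16) serves for both whenever the second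
derivatives of f vary by at most a + b·(ℓ¹ distance) (`abs_mu_le`, `abs_muStar_le`).

For f in C² one takes a = ω and b = 2ω/h, by chaining the modulus along a segment; for f in C³, a =
0 and b = ‖D³f‖. The constants 48 and 59/4 come out, below all the required ones. -/

namespace CrissCross

noncomputable section

open Set

/-! ### Taylor estimates and second differences on convex sets. -/

section

/-- The `ℓ¹` distance of two points of the plane. -/
def l1 (P Q : ℝ × ℝ) : ℝ := |P.1 - Q.1| + |P.2 - Q.2|

/-- The linear form `(x, y) ↦ a x + b y`. -/
def lin (a b : ℝ) : ℝ × ℝ →L[ℝ] ℝ :=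
  a • ContinuousLinearMap.fst ℝ ℝ ℝ + b • ContinuousLinearMap.snd ℝ ℝ ℝ

@[simp] theorem lin_apply (a b : ℝ) (v : ℝ × ℝ) : lin a b v = a * v.1 + b * v.2 := by
  simp [lin]

theorem eq_lin (φ : ℝ × ℝ →L[ℝ] ℝ) : φ = lin (φ (1, 0)) (φ (0, 1)) := by
  ext <;> simp

/-- `gx, gy` are the first and `gxx, gxy, gyy` the second partial derivatives of `g` on `S`. -/
def HasJet (S : Set (ℝ × ℝ)) (g gx gy gxx gxy gyy : ℝ × ℝ → ℝ) : Prop :=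
  ∀ p ∈ S, HasFDerivWithinAt g (lin (gx p) (gy p)) S p ∧
    HasFDerivWithinAt gx (lin (gxx p) (gxy p)) S p ∧
    HasFDerivWithinAt gy (lin (gxy p) (gyy p)) S p

/-! ### Functions on a segment -/

theorem hasDerivWithinAt_segment {S : Set (ℝ × ℝ)} (hS : Convex ℝ S) {g : ℝ × ℝ → ℝ}
    {gx gy : ℝ × ℝ → ℝ} (hg : ∀ p ∈ S, HasFDerivWithinAt g (lin (gx p) (gy p)) S p)
    {P Q : ℝ × ℝ} (hP : P ∈ S) (hQ : Q ∈ S) {t : ℝ} (ht : t ∈ Icc (0 : ℝ) 1) :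
    HasDerivWithinAt (fun t : ℝ => g (P + t • (Q - P)))
      (gx (P + t • (Q - P)) * (Q.1 - P.1) + gy (P + t • (Q - P)) * (Q.2 - P.2))
      (Icc 0 1) t := by
  have hm : MapsTo (fun t : ℝ => P + t • (Q - P)) (Icc 0 1) S := fun s hs =>
    hS.add_smul_sub_mem hP hQ hs
  have hd : HasDerivWithinAt (fun t : ℝ => P + t • (Q - P)) (Q - P) (Icc 0 1) t := by
    have := ((hasDerivAt_id t).smul_const (Q - P)).const_add P
    simpa using this.hasDerivWithinAt
  exact ((hg _ (hm ht)).comp_hasDerivWithinAt t hd hm).congr_deriv (by simp)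

theorem abs_le_of_deriv_le {φ φ' B B' : ℝ → ℝ}
    (h : ∀ t ∈ Icc (0 : ℝ) 1, HasDerivWithinAt φ (φ' t) (Icc 0 1) t) (h0 : |φ 0| ≤ B 0)
    (hB : ∀ t, HasDerivAt B (B' t) t) (hb : ∀ t ∈ Icc (0 : ℝ) 1, |φ' t| ≤ B' t) :
    ∀ t ∈ Icc (0 : ℝ) 1, |φ t| ≤ B t := by
  intro t ht
  refine image_norm_le_of_norm_deriv_right_le_deriv_boundary
    (fun s hs => (h s hs).continuousWithinAt) (fun s hs => ?_) h0 hB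
    (fun s hs => hb s (Ico_subset_Icc_self hs)) ht
  exact (h s (Ico_subset_Icc_self hs)).mono_of_mem_nhdsWithin (Icc_mem_nhdsGE_of_mem hs)

/-- Integrating the bound a + bt twice over [0, 1] gives a/2 + b/6. -/
theorem abs_sub_sub_le_of_second_deriv_le {φ φ' φ'' : ℝ → ℝ} {a b : ℝ}
    (h : ∀ t ∈ Icc (0 : ℝ) 1, HasDerivWithinAt φ (φ' t) (Icc 0 1) t)
    (h' : ∀ t ∈ Icc (0 : ℝ) 1, HasDerivWithinAt φ' (φ'' t) (Icc 0 1) t)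
    (hb : ∀ t ∈ Icc (0 : ℝ) 1, |φ'' t| ≤ a + b * t) :
    |φ 1 - φ 0 - φ' 0| ≤ a / 2 + b / 6 := by
  have h1 : ∀ t ∈ Icc (0 : ℝ) 1, |φ' t - φ' 0| ≤ a * t + b * t ^ 2 / 2 := by
    refine abs_le_of_deriv_le (φ := fun t => φ' t - φ' 0)
      (B := fun t => a * t + b * t ^ 2 / 2) (B' := fun t => a + b * t)
      (fun t ht => (h' t ht).sub_const _) (by simp) (fun t => ?_) hb
    exact (((hasDerivAt_id' t).const_mul a).add
      ((((hasDerivAt_id' t).pow 2).const_mul b).div_const 2)).congr_deriv (by simp; ring)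
  have h2 : ∀ t ∈ Icc (0 : ℝ) 1, |φ t - φ 0 - φ' 0 * t| ≤ a * t ^ 2 / 2 + b * t ^ 3 / 6 := by
    refine abs_le_of_deriv_le (φ := fun t => φ t - φ 0 - φ' 0 * t)
      (φ' := fun t => φ' t - φ' 0)
      (B := fun t => a * t ^ 2 / 2 + b * t ^ 3 / 6)
      (B' := fun t => a * t + b * t ^ 2 / 2)
      (fun t ht => ?_) (by simp) (fun t => ?_) h1
    · exact (((h t ht).sub_const (φ 0)).sub
        ((hasDerivWithinAt_id t (Icc 0 1)).const_mul (φ' 0))).congr_deriv (by simp)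
    · exact (((((hasDerivAt_id' t).pow 2).const_mul a).div_const 2).add
        ((((hasDerivAt_id' t).pow 3).const_mul b).div_const 6)).congr_deriv (by simp; ring)
  have := h2 1 (by simp)
  simpa using this

theorem HasJet.taylor {S : Set (ℝ × ℝ)} (hS : Convex ℝ S) {g gx gy gxx gxy gyy : ℝ × ℝ → ℝ}
    (hg : HasJet S g gx gy gxx gxy gyy) {P Q : ℝ × ℝ} (hP : P ∈ S) (hQ : Q ∈ S) {a b : ℝ}
    (hb : ∀ t ∈ Icc (0 : ℝ) 1,
      |gxx (P + t • (Q - P)) * (Q.1 - P.1) ^ 2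
        + 2 * (gxy (P + t • (Q - P)) * (Q.1 - P.1) * (Q.2 - P.2))
        + gyy (P + t • (Q - P)) * (Q.2 - P.2) ^ 2| ≤ a + b * t) :
    |g Q - g P - (gx P * (Q.1 - P.1) + gy P * (Q.2 - P.2))| ≤ a / 2 + b / 6 := by
  have := abs_sub_sub_le_of_second_deriv_le (φ := fun t : ℝ => g (P + t • (Q - P)))
    (φ' := fun t : ℝ => gx (P + t • (Q - P)) * (Q.1 - P.1)
      + gy (P + t • (Q - P)) * (Q.2 - P.2)) (a := a) (b := b)
    (fun t ht => hasDerivWithinAt_segment hS (fun p hp => (hg p hp).1) hP hQ ht)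
    (fun t ht =>
      ((hasDerivWithinAt_segment hS (fun p hp => (hg p hp).2.1) hP hQ ht).mul_const _).add
      ((hasDerivWithinAt_segment hS (fun p hp => (hg p hp).2.2) hP hQ ht).mul_const _))
    (fun t ht => by
      have := hb t ht
      refine le_trans (le_of_eq ?_) this
      congr 1; ring)
  simpa using this

theorem abs_sub_le_of_partials_le {S : Set (ℝ × ℝ)} (hS : Convex ℝ S) {g gx gy : ℝ × ℝ → ℝ}
    (hg : ∀ p ∈ S, HasFDerivWithinAt g (lin (gx p) (gy p)) S p) {N : ℝ}
    (hx : ∀ p ∈ S, |gx p| ≤ N) (hy : ∀ p ∈ S, |gy p| ≤ N) {P Q : ℝ × ℝ} (hP : P ∈ S)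
    (hQ : Q ∈ S) : |g P - g Q| ≤ N * l1 P Q := by
  have := norm_image_sub_le_of_norm_deriv_le_segment_01' (f := fun t : ℝ => g (Q + t • (P - Q)))
    (C := N * l1 P Q) (fun t ht => hasDerivWithinAt_segment hS hg hQ hP ht) (fun t ht => by
      have hm := hS.add_smul_sub_mem hQ hP (Ico_subset_Icc_self ht)
      rw [Real.norm_eq_abs, l1, mul_add]
      refine (abs_add_le _ _).trans ?_
      rw [abs_mul, abs_mul]
      gcongr
      · exact hx _ hm
      · exact hy _ hm)
  simpa using this

/-! ### Second differences along the axes -/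

/-- In the weighted sum the first-order terms -pq·gx and +pq·gx cancel. The Taylor remainders
contribute q·Cp²/2 + p·Cq²/2. -/
theorem HasJet.second_diff_fst {S : Set (ℝ × ℝ)} (hS : Convex ℝ S)
    {g gx gy gxx gxy gyy : ℝ × ℝ → ℝ} (hg : HasJet S g gx gy gxx gxy gyy) {x y p q C : ℝ}
    (hp : 0 ≤ p) (hq : 0 ≤ q) (hm : (x, y) ∈ S) (h₁ : (x - p, y) ∈ S) (h₂ : (x + q, y) ∈ S)
    (hC : ∀ z, (z, y) ∈ S → |z - x| ≤ max p q → |gxx (z, y)| ≤ C) :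
    |q * (g (x - p, y) - g (x, y)) + p * (g (x + q, y) - g (x, y))| ≤ C * (p * q * (p + q)) / 2 := by
  have key : ∀ d : ℝ, |d| ≤ max p q → (x + d, y) ∈ S →
      |g (x + d, y) - g (x, y) - gx (x, y) * d| ≤ C * d ^ 2 / 2 := by
    intro d hd hmd
    have := hg.taylor hS (P := (x, y)) (Q := (x + d, y)) (a := C * d ^ 2) (b := 0) hm hmd
      (fun t ht => by
        have h3 := hS.add_smul_sub_mem hm hmd ht
        have h4 : (x, y) + t • ((x + d, y) - (x, y)) = (x + t * d, y) := by
          ext <;> simp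
        rw [h4] at h3 ⊢
        have h5 := hC _ h3 (by
          rw [add_sub_cancel_left, abs_mul, abs_of_nonneg ht.1]
          exact le_trans (mul_le_of_le_one_left (abs_nonneg _) ht.2) hd)
        simp only [add_sub_cancel_left, sub_self]
        simp only [mul_zero, zero_mul, add_zero, ne_eq, OfNat.ofNat_ne_zero, not_false_eq_true,
          zero_pow, abs_mul, abs_pow, sq_abs]
        gcongr)
    simpa using this
  have e1 := key (-p) (by rw [abs_neg, abs_of_nonneg hp]; exact le_max_left _ _)
    (by rwa [← sub_eq_add_neg])
  have e2 := key q (by rw [abs_of_nonneg hq]; exact le_max_right _ _) h₂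
  rw [← sub_eq_add_neg] at e1
  rw [abs_le] at e1 e2 ⊢
  constructor <;> nlinarith [mul_le_mul_of_nonneg_left e1.1 hq, mul_le_mul_of_nonneg_left e1.2 hq,
    mul_le_mul_of_nonneg_left e2.1 hp, mul_le_mul_of_nonneg_left e2.2 hp]

/-- Lets each estimate in the second variable follow from its counterpart in the first. -/
theorem HasJet.swap {S : Set (ℝ × ℝ)} {g gx gy gxx gxy gyy : ℝ × ℝ → ℝ}
    (hg : HasJet S g gx gy gxx gxy gyy) :
    HasJet (Prod.swap ⁻¹' S) (g ∘ Prod.swap) (gy ∘ Prod.swap) (gx ∘ Prod.swap)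
      (gyy ∘ Prod.swap) (gxy ∘ Prod.swap) (gxx ∘ Prod.swap) := by
  have key : ∀ (φ φx φy : ℝ × ℝ → ℝ) (p : ℝ × ℝ),
      HasFDerivWithinAt φ (lin (φx p.swap) (φy p.swap)) S p.swap →
      HasFDerivWithinAt (φ ∘ Prod.swap) (lin (φy p.swap) (φx p.swap)) (Prod.swap ⁻¹' S) p := by
    intro φ φx φy p h
    have hs : HasFDerivWithinAt (Prod.swap : ℝ × ℝ → ℝ × ℝ)
        (ContinuousLinearMap.prod (ContinuousLinearMap.snd ℝ ℝ ℝ)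
          (ContinuousLinearMap.fst ℝ ℝ ℝ)) (Prod.swap ⁻¹' S) p :=
      (ContinuousLinearMap.prod (ContinuousLinearMap.snd ℝ ℝ ℝ)
          (ContinuousLinearMap.fst ℝ ℝ ℝ)).hasFDerivWithinAt
    exact (h.comp p hs (fun _ h => h)).congr_fderiv (by ext <;> simp)
  intro p hp
  obtain ⟨h1, h2, h3⟩ := hg p.swap hp
  exact ⟨key _ _ _ p h1, key _ _ _ p h3, key _ _ _ p h2⟩

theorem HasJet.second_diff_snd {S : Set (ℝ × ℝ)} (hS : Convex ℝ S)
    {g gx gy gxx gxy gyy : ℝ × ℝ → ℝ} (hg : HasJet S g gx gy gxx gxy gyy) {x y p q C : ℝ}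
    (hp : 0 ≤ p) (hq : 0 ≤ q) (hm : (x, y) ∈ S) (h₁ : (x, y - p) ∈ S) (h₂ : (x, y + q) ∈ S)
    (hC : ∀ z, (x, z) ∈ S → |z - y| ≤ max p q → |gyy (x, z)| ≤ C) :
    |q * (g (x, y - p) - g (x, y)) + p * (g (x, y + q) - g (x, y))| ≤ C * (p * q * (p + q)) / 2 :=
  hg.swap.second_diff_fst (x := y) (y := x)
    (hS.linear_preimage (LinearEquiv.prodComm ℝ ℝ ℝ).toLinearMap) hp hq hm h₁ h₂ hC

/-! ### Subtracting a quadratic polynomial -/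

/-- The polynomial `c₀ + c₁ x + c₂ y + c₃ x² + c₄ x y + c₅ y²`. -/
def quad (c₀ c₁ c₂ c₃ c₄ c₅ : ℝ) (p : ℝ × ℝ) : ℝ :=
  c₀ + c₁ * p.1 + c₂ * p.2 + c₃ * p.1 ^ 2 + c₄ * (p.1 * p.2) + c₅ * p.2 ^ 2

theorem hasFDerivAt_quad (c₀ c₁ c₂ c₃ c₄ c₅ : ℝ) (p : ℝ × ℝ) :
    HasFDerivAt (quad c₀ c₁ c₂ c₃ c₄ c₅)
      (lin (quad c₁ (2 * c₃) c₄ 0 0 0 p) (quad c₂ c₄ (2 * c₅) 0 0 0 p)) p := by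
  have hx : HasFDerivAt (fun p : ℝ × ℝ => p.1) (ContinuousLinearMap.fst ℝ ℝ ℝ) p := hasFDerivAt_fst
  have hy : HasFDerivAt (fun p : ℝ × ℝ => p.2) (ContinuousLinearMap.snd ℝ ℝ ℝ) p := hasFDerivAt_snd
  have := (((((hasFDerivAt_const c₀ p).add (hx.const_mul c₁)).add (hy.const_mul c₂)).add
    ((hx.pow 2).const_mul c₃)).add ((hx.mul hy).const_mul c₄)).add ((hy.pow 2).const_mul c₅)
  refine (this.congr_of_eventuallyEq (Filter.Eventually.of_forall fun p => ?_)).congr_fderiv ?_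
  · simp [quad]
  · ext <;> simp [quad] <;> ring

theorem HasJet.sub_quad {S : Set (ℝ × ℝ)} {g gx gy gxx gxy gyy : ℝ × ℝ → ℝ}
    (hg : HasJet S g gx gy gxx gxy gyy) (c₀ c₁ c₂ c₃ c₄ c₅ : ℝ) :
    HasJet S (fun p => g p - quad c₀ c₁ c₂ c₃ c₄ c₅ p)
      (fun p => gx p - quad c₁ (2 * c₃) c₄ 0 0 0 p) (fun p => gy p - quad c₂ c₄ (2 * c₅) 0 0 0 p)
      (fun p => gxx p - 2 * c₃) (fun p => gxy p - c₄) (fun p => gyy p - 2 * c₅) := by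
  have sub : ∀ a b c d, lin a b - lin c d = lin (a - c) (b - d) := fun a b c d => by
    ext <;> simp
  intro p hp
  obtain ⟨h1, h2, h3⟩ := hg p hp
  refine ⟨?_, ?_, ?_⟩
  · exact (h1.sub (hasFDerivAt_quad c₀ c₁ c₂ c₃ c₄ c₅ p).hasFDerivWithinAt).congr_fderiv
      (sub _ _ _ _)
  · exact (h2.sub (hasFDerivAt_quad c₁ (2 * c₃) c₄ 0 0 0 p).hasFDerivWithinAt).congr_fderiv
      (by rw [sub]; simp [quad])
  · exact (h3.sub (hasFDerivAt_quad c₂ c₄ (2 * c₅) 0 0 0 p).hasFDerivWithinAt).congr_fderiv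
      (by rw [sub]; simp [quad])

/-- The remainder of the Taylor polynomial of degree two at `E`. -/
theorem HasJet.exists_taylor_remainder {S : Set (ℝ × ℝ)} (hS : Convex ℝ S)
    {f fx fy fxx fxy fyy : ℝ × ℝ → ℝ} (hf : HasJet S f fx fy fxx fxy fyy) {E : ℝ × ℝ} (hE : E ∈ S)
    {a b : ℝ}
    (hxx : ∀ P ∈ S, |fxx P - fxx E| ≤ a + b * l1 P E)
    (hxy : ∀ P ∈ S, |fxy P - fxy E| ≤ a + b * l1 P E)
    (hyy : ∀ P ∈ S, |fyy P - fyy E| ≤ a + b * l1 P E) :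
    ∃ c₀ c₁ c₂ : ℝ, ∃ g gx gy gxx gxy gyy : ℝ × ℝ → ℝ, HasJet S g gx gy gxx gxy gyy ∧
      (∀ P, f P = quad c₀ c₁ c₂ (fxx E / 2) (fxy E) (fyy E / 2) P + g P) ∧
      (∀ P ∈ S, |gxx P| ≤ a + b * l1 P E) ∧ (∀ P ∈ S, |gyy P| ≤ a + b * l1 P E) ∧
      (∀ P ∈ S, |g P| ≤ l1 P E ^ 2 * (a / 2 + b * l1 P E / 6)) := by
  have hg0 := hf.sub_quad 0 0 0 (fxx E / 2) (fxy E) (fyy E / 2)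
  obtain ⟨X, Y⟩ := E
  set E : ℝ × ℝ := (X, Y)
  -- The polynomial is written in powers of x and y, not centred at E; these constants make the
  -- remainder and its gradient vanish at E.
  obtain ⟨c₁, hc₁⟩ : ∃ c, c = fx E - quad 0 (fxx E) (fxy E) 0 0 0 E := ⟨_, rfl⟩
  obtain ⟨c₂, hc₂⟩ : ∃ c, c = fy E - quad 0 (fxy E) (fyy E) 0 0 0 E := ⟨_, rfl⟩
  obtain ⟨c₀, hc₀⟩ : ∃ c, c = f E - quad 0 c₁ c₂ (fxx E / 2) (fxy E) (fyy E / 2) E := ⟨_, rfl⟩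
  have hg := hf.sub_quad c₀ c₁ c₂ (fxx E / 2) (fxy E) (fyy E / 2)
  refine ⟨c₀, c₁, c₂, _, _, _, _, _, _, hg, fun P => by ring, fun P hP => ?_, fun P hP => ?_,
    fun P hP => ?_⟩
  · have := hxx P hP
    rwa [show fxx P - 2 * (fxx E / 2) = fxx P - fxx E by ring]
  · have := hyy P hP
    rwa [show fyy P - 2 * (fyy E / 2) = fyy P - fyy E by ring]
  · have := hg.taylor hS (P := E) (Q := P) (a := a * l1 P E ^ 2) (b := b * l1 P E * l1 P E ^ 2)
      hE hP (fun t ht => by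
        have hm := hS.add_smul_sub_mem hE hP ht
        -- The ℓ¹ distance to E grows linearly along the segment, so the bound on the second
        -- derivatives becomes affine in t. The quadratic form is at most C(|dx| + |dy|)², which is
        -- why ℓ¹ is the convenient distance.
        have hl : l1 (E + t • (P - E)) E = t * l1 P E := by
          simp [l1, abs_mul, abs_of_nonneg ht.1, mul_add]
        have h1 := hxx _ hm
        have h2 := hxy _ hm
        have h3 := hyy _ hm
        rw [hl] at h1 h2 h3
        rw [show ∀ z, fxx z - 2 * (fxx E / 2) = fxx z - fxx E by intro z; ring,
          show ∀ z, fyy z - 2 * (fyy E / 2) = fyy z - fyy E by intro z; ring]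
        refine (abs_add_le _ _).trans ((add_le_add_left (abs_add_le _ _) _).trans ?_)
        simp only [abs_mul, abs_pow, abs_two]
        set C := a + b * (t * l1 P E)
        calc _ ≤ C * |P.1 - E.1| ^ 2 + 2 * (C * |P.1 - E.1| * |P.2 - E.2|)
              + C * |P.2 - E.2| ^ 2 := by gcongr
          _ = C * l1 P E ^ 2 := by rw [l1]; ring
          _ = _ := by simp only [C]; ring)
    have e1 : fx E - quad c₁ (2 * (fxx E / 2)) (fxy E) 0 0 0 E = 0 := by
      rw [hc₁]; simp only [quad]; ring
    have e2 : fy E - quad c₂ (fxy E) (2 * (fyy E / 2)) 0 0 0 E = 0 := by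
      rw [hc₂]; simp only [quad]; ring
    have e3 : f E - quad c₀ c₁ c₂ (fxx E / 2) (fxy E) (fyy E / 2) E = 0 := by
      rw [hc₀]; simp only [quad]; ring
    simp only [e1, e2, e3] at this
    refine le_trans (le_of_eq ?_) (this.trans (le_of_eq ?_))
    · congr 1; ring
    · ring

end

/-! ### Knots, the coefficient functionals, and bounds for them. -/

section

namespace Knots

variable (K : Knots)

theorem x_mono : Monotone K.x := fun i j hij => K.mono.monotone <| by
  simp only [Fin.mk_le_mk]
  have := Int.toNat_le_toNat hij
  omega

theorem x_lt {i j : ℤ} (hij : i < j) (hj : 0 < j) (hi : i < K.N) : K.x i < K.x j := K.mono <| by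
  simp only [Fin.mk_lt_mk]
  have := K.pos
  omega

theorem x_of_nonpos {i : ℤ} (hi : i ≤ 0) : K.x i = K.x 0 := by
  simp [x, Int.toNat_of_nonpos hi]

theorem x_of_ge {i : ℤ} (hi : (K.N : ℤ) ≤ i) : K.x i = K.x K.N := by
  have : K.N ≤ i.toNat := by omega
  simp [x, this]

theorem x_mem (i : ℤ) : K.x i ∈ K.interval := by
  constructor
  · rcases le_total i 0 with h | h
    · rw [K.x_of_nonpos h]
    · exact K.x_mono h
  · rcases le_total i K.N with h | h
    · exact K.x_mono h
    · rw [K.x_of_ge h]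

theorem convex_interval : Convex ℝ K.interval := convex_Icc _ _

theorem mid_mem (i : ℤ) : K.mid i ∈ K.interval := by
  have h1 := K.x_mem (i - 1)
  have h2 := K.x_mem i
  rw [mid]
  constructor <;> linarith [h1.1, h1.2, h2.1, h2.2]

theorem step_nonneg (i : ℤ) : 0 ≤ K.step i := sub_nonneg.2 (K.x_mono (by omega))

theorem step_pos {i : ℤ} (h1 : 1 ≤ i) (h2 : i ≤ K.N) : 0 < K.step i :=
  sub_pos.2 (K.x_lt (by omega) (by omega) (by omega))

theorem step_eq_zero {i : ℤ} (h : ¬(1 ≤ i ∧ i ≤ K.N)) : K.step i = 0 := by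
  rw [step, sub_eq_zero]
  rcases lt_or_ge i 1 with h1 | h1
  · rw [K.x_of_nonpos (i := i) (by omega), K.x_of_nonpos (i := i - 1) (by omega)]
  · rw [K.x_of_ge (i := i) (by omega), K.x_of_ge (i := i - 1) (by omega)]

theorem minStep_le {i : ℤ} (h1 : 1 ≤ i) (h2 : i ≤ K.N) : K.minStep ≤ K.step i :=
  Finset.inf'_le _ (Finset.mem_Icc.2 ⟨h1, h2⟩)

theorem minStep_pos : 0 < K.minStep := by
  rw [minStep, Finset.lt_inf'_iff]
  intro i hi
  rw [Finset.mem_Icc] at hi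
  exact K.step_pos hi.1 hi.2

theorem step_le_maxStep (i : ℤ) : K.step i ≤ K.maxStep := by
  have hle : ∀ i ∈ Finset.Icc (1 : ℤ) K.N, K.step i ≤ K.maxStep := fun i hi =>
    Finset.le_sup' K.step hi
  by_cases h : 1 ≤ i ∧ i ≤ K.N
  · exact hle i (Finset.mem_Icc.2 h)
  · rw [K.step_eq_zero h]
    obtain ⟨k, hk⟩ := K.idx_nonempty
    exact (K.step_nonneg k).trans (hle k hk)

theorem minStep_le_maxStep : K.minStep ≤ K.maxStep := by
  have := K.minStep_le le_rfl (by exact_mod_cast K.pos)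
  exact this.trans (K.step_le_maxStep 1)

theorem x_sub_one (i : ℤ) : K.x (i - 1) = K.x i - K.step i := by rw [step]; ring

theorem mid_eq_sub (i : ℤ) : K.mid i = K.x i - K.step i / 2 := by rw [mid, step]; ring

theorem mid_sub_mid (i : ℤ) : K.mid i - K.mid (i - 1) = (K.step (i - 1) + K.step i) / 2 := by
  rw [mid, mid, step, step]; ring

/-- Strictly between x_{r-1} and x_r, the knots not exceeding t are x_0, ..., x_{r-1}, which are r
in number. -/
theorem col_eq {r : ℤ} (h1 : 1 ≤ r) (h2 : r ≤ K.N) {t : ℝ} (ht : t ∈ Ioo (K.x (r - 1)) (K.x r)) :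
    K.col t = r := by
  have : (Finset.range K.N).filter (fun i : ℕ => K.x (i : ℤ) ≤ t) = Finset.range r.toNat := by
    ext i
    simp only [Finset.mem_filter, Finset.mem_range]
    constructor
    · rintro ⟨_, h⟩
      by_contra hc
      exact absurd (K.x_mono (show r ≤ i by omega)) (not_le.2 (h.trans_lt ht.2))
    · intro h
      exact ⟨by omega, (K.x_mono (show (i : ℤ) ≤ r - 1 by omega)).trans ht.1.le⟩
  rw [col, this, Finset.card_range]
  omega

/-! ### The ratios `σ_i`, `σ'_i` -/

theorem sig_nonneg (i : ℤ) : 0 ≤ K.sig i :=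
  div_nonneg (K.step_nonneg _) (add_nonneg (K.step_nonneg _) (K.step_nonneg _))

theorem sig'_nonneg (i : ℤ) : 0 ≤ K.sig' i :=
  div_nonneg (K.step_nonneg _) (add_nonneg (K.step_nonneg _) (K.step_nonneg _))

theorem step_add_step_pos {i : ℤ} (h1 : 1 ≤ i) (h2 : i ≤ K.N + 1) :
    0 < K.step (i - 1) + K.step i := by
  by_cases h : i ≤ K.N
  · exact add_pos_of_nonneg_of_pos (K.step_nonneg _) (K.step_pos h1 h)
  · have := K.pos
    exact add_pos_of_pos_of_nonneg (K.step_pos (by omega) (by omega)) (K.step_nonneg _)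

/-- The index range makes the common denominator positive; elsewhere both ratios are 0/0 = 0 and the
identity fails. -/
theorem sig_add_sig' {i : ℤ} (h1 : 1 ≤ i) (h2 : i ≤ K.N + 1) : K.sig i + K.sig' i = 1 := by
  have := K.step_add_step_pos h1 h2
  rw [sig, sig']
  field_simp
  ring

theorem sig_mul_step (i : ℤ) : K.sig i * K.step (i - 1) = K.sig' i * K.step i := by
  rw [sig, sig']; ring

/-- With `sig_x_mul_x`, the blossom identities by which the univariate spline reproduces degrees one
and two at a knot. -/
theorem sig_mid {i : ℤ} (h1 : 1 ≤ i) (h2 : i ≤ K.N + 1) :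
    K.sig i * K.mid (i - 1) + K.sig' i * K.mid i = K.x (i - 1) := by
  have e1 := K.sig_add_sig' h1 h2
  have e2 := K.sig_mul_step i
  simp only [step, mid] at *
  linear_combination K.x (i - 1) * e1 - e2 / 2

theorem sig_x_mul_x {i : ℤ} (h1 : 1 ≤ i) (h2 : i ≤ K.N + 1) :
    K.sig i * (K.x (i - 1 - 1) * K.x (i - 1)) + K.sig' i * (K.x (i - 1) * K.x i)
      = K.x (i - 1) ^ 2 := by
  have e1 := K.sig_add_sig' h1 h2
  have e2 := K.sig_mul_step i
  simp only [step] at *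
  linear_combination K.x (i - 1) ^ 2 * e1 - e2 * K.x (i - 1)

/-! ### The coefficients `a_i`, `c_i` -/

/-- With p, q the gaps between neighbouring midpoints, σ_i = h_i/(2p) and σ'_{i+1} = h_i/(2q). So
a_i and c_i are the outer weights of -(h_i²/4) times the second divided difference at s_{i-1}, s_i,
s_{i+1}. -/
theorem a_c_eq {i : ℤ} (h1 : 1 ≤ i) (h2 : i ≤ K.N) {p q : ℝ}
    (hp : p = K.mid i - K.mid (i - 1)) (hq : q = K.mid (i + 1) - K.mid i) :
    0 < p ∧ 0 < q ∧ K.a i = -(K.step i ^ 2 / 4 / (p * q * (p + q))) * q ∧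
      K.c i = -(K.step i ^ 2 / 4 / (p * q * (p + q))) * p := by
  have hs := K.step_pos h1 h2
  have hp' : p = (K.step (i - 1) + K.step i) / 2 := by rw [hp, mid_sub_mid]
  have hq' : q = (K.step i + K.step (i + 1)) / 2 := by
    have := K.mid_sub_mid (i + 1)
    rw [add_sub_cancel_right] at this
    rw [hq, this]
  have p0 : 0 < p := by have := K.step_nonneg (i - 1); linarith
  have q0 : 0 < q := by have := K.step_nonneg (i + 1); linarith
  have e1 : K.sig i = K.step i / (2 * p) := by rw [sig, hp']; congr 1; ring
  have e2 : K.sig' (i + 1) = K.step i / (2 * q) := by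
    rw [sig', hq', add_sub_cancel_right]; congr 1; ring
  refine ⟨p0, q0, ?_, ?_⟩
  · rw [a, if_pos ⟨h1, h2⟩, e1, e2]
    field_simp
    ring
  · rw [c, if_pos ⟨h1, h2⟩, e1, e2]
    field_simp
    ring

theorem a_c_linear (i : ℤ) :
    K.a i * (K.mid (i - 1) - K.mid i) + K.c i * (K.mid (i + 1) - K.mid i) = 0 := by
  by_cases h : 1 ≤ i ∧ i ≤ K.N
  · obtain ⟨_, _, ha, hc⟩ := K.a_c_eq h.1 h.2 rfl rfl
    rw [ha, hc]; ring
  · simp [a, c, h]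

/-- The right side is x_{i-1}x_i - s_i², the correction that turns the value of a square at s_i into
its blossom. For the end indices both sides vanish. -/
theorem a_c_sq (i : ℤ) :
    K.a i * (K.mid (i - 1) ^ 2 - K.mid i ^ 2) + K.c i * (K.mid (i + 1) ^ 2 - K.mid i ^ 2)
      = -(K.step i ^ 2 / 4) := by
  by_cases h : 1 ≤ i ∧ i ≤ K.N
  · obtain ⟨p, hp⟩ : ∃ p, p = K.mid i - K.mid (i - 1) := ⟨_, rfl⟩
    obtain ⟨q, hq⟩ : ∃ q, q = K.mid (i + 1) - K.mid i := ⟨_, rfl⟩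
    obtain ⟨p0, q0, ha, hc⟩ := K.a_c_eq h.1 h.2 hp hq
    rw [ha, hc, show K.mid (i - 1) = K.mid i - p by rw [hp]; ring,
      show K.mid (i + 1) = K.mid i + q by rw [hq]; ring]
    field_simp
    ring
  · simp [a, c, h, K.step_eq_zero h]

end Knots

variable (K L : Knots)

theorem hmin_pos : 0 < hmin K L := lt_min K.minStep_pos L.minStep_pos

theorem hmin_le_hmax : hmin K L ≤ hmax K L :=
  (min_le_left _ _).trans (K.minStep_le_maxStep.trans (le_max_left _ _))

theorem hmax_pos : 0 < hmax K L := (hmin_pos K L).trans_le (hmin_le_hmax K L)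

theorem step_le_hmax_left (i : ℤ) : K.step i ≤ hmax K L :=
  (K.step_le_maxStep i).trans (le_max_left _ _)

theorem step_le_hmax_right (j : ℤ) : L.step j ≤ hmax K L :=
  (L.step_le_maxStep j).trans (le_max_right _ _)

theorem hmin_le_step_left {i : ℤ} (h1 : 1 ≤ i) (h2 : i ≤ K.N) : hmin K L ≤ K.step i :=
  (min_le_left _ _).trans (K.minStep_le h1 h2)

theorem hmin_le_step_right {j : ℤ} (h1 : 1 ≤ j) (h2 : j ≤ L.N) : hmin K L ≤ L.step j :=
  (min_le_right _ _).trans (L.minStep_le h1 h2)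

theorem convex_Omega : Convex ℝ (Omega K L) := K.convex_interval.prod L.convex_interval

/-! ### The coefficient functionals -/

theorem muStar_add (f g : ℝ × ℝ → ℝ) (i j : ℤ) :
    muStar K L (fun p => f p + g p) i j = muStar K L f i j + muStar K L g i j := by
  simp only [muStar]; ring

theorem mu_add (f g : ℝ × ℝ → ℝ) (i j : ℤ) :
    mu K L (fun p => f p + g p) i j = mu K L f i j + mu K L g i j := by
  simp only [mu]; ring

/-- The blossom of `quad` at `(x_{i-1}, x_i; y_{j-1}, y_j)`. -/
def blossom (c₀ c₁ c₂ c₃ c₄ c₅ : ℝ) (i j : ℤ) : ℝ :=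
  c₀ + c₁ * K.mid i + c₂ * L.mid j + c₃ * (K.x (i - 1) * K.x i) + c₄ * (K.mid i * L.mid j)
    + c₅ * (L.x (j - 1) * L.x j)

theorem mu_eq (f : ℝ × ℝ → ℝ) (i j : ℤ) :
    mu K L f i j = f (M K L i j)
      + (K.a i * (f (M K L (i - 1) j) - f (M K L i j))
        + K.c i * (f (M K L (i + 1) j) - f (M K L i j)))
      + (L.a j * (f (M K L i (j - 1)) - f (M K L i j))
        + L.c j * (f (M K L i (j + 1)) - f (M K L i j))) := by
  rw [mu]; ring

theorem mu_quad (c₀ c₁ c₂ c₃ c₄ c₅ : ℝ) (i j : ℤ) :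
    mu K L (quad c₀ c₁ c₂ c₃ c₄ c₅) i j = blossom K L c₀ c₁ c₂ c₃ c₄ c₅ i j := by
  rw [mu_eq]
  have e1 := K.a_c_linear i
  have e2 := K.a_c_sq i
  have e3 := L.a_c_linear j
  have e4 := L.a_c_sq j
  have e5 : K.x (i - 1) * K.x i = K.mid i ^ 2 - K.step i ^ 2 / 4 := by
    rw [Knots.mid, Knots.step]; ring
  have e6 : L.x (j - 1) * L.x j = L.mid j ^ 2 - L.step j ^ 2 / 4 := by
    rw [Knots.mid, Knots.step]; ring
  simp only [quad, blossom, M, e5, e6]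
  linear_combination (c₁ + c₄ * L.mid j) * e1 + c₃ * e2 + (c₂ + c₄ * K.mid i) * e3 + c₅ * e4

theorem muStar_quad (c₀ c₁ c₂ c₃ c₄ c₅ : ℝ) (i j : ℤ) :
    muStar K L (quad c₀ c₁ c₂ c₃ c₄ c₅) i j = blossom K L c₀ c₁ c₂ c₃ c₄ c₅ i j := by
  simp only [muStar, quad, blossom, M, A, Knots.mid]
  ring

variable {K L}

/-- The denominator pq(p+q) of the divided difference cancels against the same factor in the second
difference estimate, which leaves h_i²C/8 whatever the ratio of neighbouring steps. -/
theorem abs_a_c_le {K : Knots} {i : ℤ} {φ : ℝ → ℝ} {C h : ℝ} (hC : 0 ≤ C) (hh : K.step i ≤ h)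
    (hφ : ∀ p q, 0 ≤ p → 0 ≤ q → p = K.mid i - K.mid (i - 1) → q = K.mid (i + 1) - K.mid i →
      |q * (φ (K.mid (i - 1)) - φ (K.mid i)) + p * (φ (K.mid (i + 1)) - φ (K.mid i))|
        ≤ C * (p * q * (p + q)) / 2) :
    |K.a i * (φ (K.mid (i - 1)) - φ (K.mid i)) + K.c i * (φ (K.mid (i + 1)) - φ (K.mid i))|
      ≤ h ^ 2 * C / 8 := by
  by_cases hi : 1 ≤ i ∧ i ≤ K.N
  · obtain ⟨p, hp⟩ : ∃ p, p = K.mid i - K.mid (i - 1) := ⟨_, rfl⟩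
    obtain ⟨q, hq⟩ : ∃ q, q = K.mid (i + 1) - K.mid i := ⟨_, rfl⟩
    obtain ⟨p0, q0, ha, hc⟩ := K.a_c_eq hi.1 hi.2 hp hq
    have hb := hφ p q p0.le q0.le hp hq
    have hs := K.step_nonneg i
    have hk : 0 ≤ K.step i ^ 2 / 4 / (p * q * (p + q)) := by positivity
    rw [ha, hc]
    calc _ = K.step i ^ 2 / 4 / (p * q * (p + q)) *
        |q * (φ (K.mid (i - 1)) - φ (K.mid i)) + p * (φ (K.mid (i + 1)) - φ (K.mid i))| := by
          rw [← abs_of_nonneg hk, ← abs_mul, abs_of_nonneg hk, ← abs_neg]; congr 1; ring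
      _ ≤ K.step i ^ 2 / 4 / (p * q * (p + q)) * (C * (p * q * (p + q)) / 2) := by gcongr
      _ = K.step i ^ 2 * C / 8 := by field_simp; ring
      _ ≤ h ^ 2 * C / 8 := by gcongr
  · simp only [Knots.a, Knots.c, hi, if_false, zero_mul, add_zero, abs_zero]
    positivity

variable {g gx gy gxx gxy gyy : ℝ × ℝ → ℝ} {E : ℝ × ℝ} {a b : ℝ} {i j : ℤ}

theorem M_mem (i j : ℤ) : M K L i j ∈ Omega K L := ⟨K.mid_mem i, L.mid_mem j⟩

theorem abs_g_M_le (ha : 0 ≤ a) (hb : 0 ≤ b)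
    (hg : ∀ P ∈ Omega K L, |g P| ≤ l1 P E ^ 2 * (a / 2 + b * l1 P E / 6))
    (hE : l1 (M K L i j) E ≤ 3 / 2 * hmax K L) :
    |g (M K L i j)| ≤ hmax K L ^ 2 * (9 / 8 * a + 9 / 16 * (b * hmax K L)) := by
  have h0 : 0 ≤ l1 (M K L i j) E := by unfold l1; positivity
  calc _ ≤ _ := hg _ (M_mem i j)
    _ ≤ (3 / 2 * hmax K L) ^ 2 * (a / 2 + b * (3 / 2 * hmax K L) / 6) := by gcongr
    _ = _ := by ring

theorem l1_le_of_fst {x y z r e : ℝ} (h : l1 (x, y) E ≤ r) (hz : |z - x| ≤ e) :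
    l1 (z, y) E ≤ r + e := by
  have := abs_add_le (z - x) (x - E.1)
  rw [sub_add_sub_cancel] at this
  simp only [l1] at *
  linarith

theorem l1_le_of_snd {x y z r e : ℝ} (h : l1 (x, y) E ≤ r) (hz : |z - y| ≤ e) :
    l1 (x, z) E ≤ r + e := by
  have := abs_add_le (z - y) (y - E.2)
  rw [sub_add_sub_cancel] at this
  simp only [l1] at *
  linarith

/-- The value at M_{ij} contributes h²(9a/8 + 9bh/16). Each of the two axis terms contributes h²(a +
5bh/2)/8. -/
theorem abs_mu_le (ha : 0 ≤ a) (hb : 0 ≤ b) (hj : HasJet (Omega K L) g gx gy gxx gxy gyy)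
    (hxx : ∀ P ∈ Omega K L, |gxx P| ≤ a + b * l1 P E)
    (hyy : ∀ P ∈ Omega K L, |gyy P| ≤ a + b * l1 P E)
    (hg : ∀ P ∈ Omega K L, |g P| ≤ l1 P E ^ 2 * (a / 2 + b * l1 P E / 6))
    (hE : l1 (M K L i j) E ≤ 3 / 2 * hmax K L) :
    |mu K L g i j| ≤ hmax K L ^ 2 * (11 / 8 * a + 19 / 16 * (b * hmax K L)) := by
  have hh := hmax_pos K L
  set h := hmax K L with hh_def
  have hC : 0 ≤ a + b * (3 / 2 * h + h) := by positivity
  have h1 : |K.a i * (g (M K L (i - 1) j) - g (M K L i j))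
        + K.c i * (g (M K L (i + 1) j) - g (M K L i j))| ≤ h ^ 2 * (a + b * (3 / 2 * h + h)) / 8 := by
    refine abs_a_c_le (K := K) (i := i) (φ := fun x => g (x, L.mid j)) hC
      (step_le_hmax_left K L i) fun p q p0 q0 hp hq => ?_
    have hp' := K.mid_sub_mid i
    have hq' := K.mid_sub_mid (i + 1)
    rw [add_sub_cancel_right] at hq'
    have k1 := step_le_hmax_left K L (i - 1)
    have k2 := step_le_hmax_left K L i
    have k3 := step_le_hmax_left K L (i + 1)
    rw [show K.mid (i - 1) = K.mid i - p by rw [hp]; ring,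
      show K.mid (i + 1) = K.mid i + q by rw [hq]; ring]
    refine hj.second_diff_fst (convex_Omega K L) p0 q0 (M_mem i j) ?_ ?_ fun z hz hzm => ?_
    · have := M_mem (K := K) (L := L) (i - 1) j
      rwa [M, show K.mid (i - 1) = K.mid i - p by rw [hp]; ring] at this
    · have := M_mem (K := K) (L := L) (i + 1) j
      rwa [M, show K.mid (i + 1) = K.mid i + q by rw [hq]; ring] at this
    · refine (hxx _ hz).trans ?_
      gcongr
      -- Adjacent midpoints are at most h apart, so the second derivative is evaluated within 3h/2 +
      -- h of E.
      refine l1_le_of_fst hE (hzm.trans (max_le ?_ ?_)) <;> linarith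
  have h2 : |L.a j * (g (M K L i (j - 1)) - g (M K L i j))
        + L.c j * (g (M K L i (j + 1)) - g (M K L i j))| ≤ h ^ 2 * (a + b * (3 / 2 * h + h)) / 8 := by
    refine abs_a_c_le (K := L) (i := j) (φ := fun y => g (K.mid i, y)) hC
      (step_le_hmax_right K L j) fun p q p0 q0 hp hq => ?_
    have hp' := L.mid_sub_mid j
    have hq' := L.mid_sub_mid (j + 1)
    rw [add_sub_cancel_right] at hq'
    have k1 := step_le_hmax_right K L (j - 1)
    have k2 := step_le_hmax_right K L j
    have k3 := step_le_hmax_right K L (j + 1)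
    rw [show L.mid (j - 1) = L.mid j - p by rw [hp]; ring,
      show L.mid (j + 1) = L.mid j + q by rw [hq]; ring]
    refine hj.second_diff_snd (convex_Omega K L) p0 q0 (M_mem i j) ?_ ?_ fun z hz hzm => ?_
    · have := M_mem (K := K) (L := L) i (j - 1)
      rwa [M, show L.mid (j - 1) = L.mid j - p by rw [hp]; ring] at this
    · have := M_mem (K := K) (L := L) i (j + 1)
      rwa [M, show L.mid (j + 1) = L.mid j + q by rw [hq]; ring] at this
    · refine (hyy _ hz).trans ?_
      gcongr
      refine l1_le_of_snd hE (hzm.trans (max_le ?_ ?_)) <;> linarith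
  have h0 := abs_g_M_le ha hb hg hE
  rw [mu_eq]
  refine (abs_add_le _ _).trans ((add_le_add_left (abs_add_le _ _) _).trans ?_)
  nlinarith

theorem abs_mean_sub_le_fst (hj : HasJet (Omega K L) g gx gy gxx gxy gyy) {y C : ℝ}
    (hC0 : 0 ≤ C) (hy : y ∈ L.interval) (hC : ∀ z, (z, y) ∈ Omega K L →
      |z - K.mid i| ≤ hmax K L / 2 → |gxx (z, y)| ≤ C) :
    |(g (K.x (i - 1), y) + g (K.x i, y)) / 2 - g (K.mid i, y)| ≤ hmax K L ^ 2 * C / 8 := by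
  have k := step_le_hmax_left K L i
  have k0 := K.step_nonneg i
  -- At the end indices the knots coincide and the difference is zero; otherwise the second
  -- difference is divided by the positive step.
  rcases k0.eq_or_lt with k1 | k1
  · have : K.x (i - 1) = K.x i := by rw [K.x_sub_one, ← k1, sub_zero]
    rw [K.mid_eq_sub, ← k1, this]
    simp only [zero_div, sub_zero, add_self_div_two, sub_self, abs_zero]
    positivity
  have e1 : K.x (i - 1) = K.mid i - K.step i / 2 := by rw [Knots.mid, Knots.step]; ring
  have e2 : K.x i = K.mid i + K.step i / 2 := by rw [Knots.mid, Knots.step]; ring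
  have := hj.second_diff_fst (convex_Omega K L) (x := K.mid i) (y := y) (C := C)
    (p := K.step i / 2) (q := K.step i / 2) (by positivity) (by positivity) ⟨K.mid_mem i, hy⟩
    (by rw [← e1]; exact ⟨K.x_mem _, hy⟩) (by rw [← e2]; exact ⟨K.x_mem _, hy⟩)
    (fun z hz hzm => hC z hz (hzm.trans (by rw [max_self]; linarith)))
  rw [← e1, ← e2] at this
  have h3 : K.step i * |(g (K.x (i - 1), y) + g (K.x i, y)) / 2 - g (K.mid i, y)|
      ≤ K.step i * (K.step i ^ 2 * C / 8) := by
    rw [← abs_of_nonneg k0, ← abs_mul, abs_of_nonneg k0]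
    refine le_trans (le_of_eq ?_) (this.trans (le_of_eq ?_))
    · congr 1; ring
    · ring
  refine (le_of_mul_le_mul_left h3 k1).trans ?_
  gcongr

theorem Omega_swap (K L : Knots) : Prod.swap ⁻¹' Omega K L = Omega L K := by
  rw [Omega, Omega, Set.preimage_swap_prod]

theorem hmax_comm (K L : Knots) : hmax K L = hmax L K := max_comm _ _

theorem abs_mean_sub_le_snd (hj : HasJet (Omega K L) g gx gy gxx gxy gyy) {x C : ℝ}
    (hC0 : 0 ≤ C) (hx : x ∈ K.interval) (hC : ∀ z, (x, z) ∈ Omega K L →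
      |z - L.mid j| ≤ hmax K L / 2 → |gyy (x, z)| ≤ C) :
    |(g (x, L.x (j - 1)) + g (x, L.x j)) / 2 - g (x, L.mid j)| ≤ hmax K L ^ 2 * C / 8 := by
  have hs := hj.swap
  rw [Omega_swap] at hs
  rw [hmax_comm]
  refine abs_mean_sub_le_fst hs hC0 hx fun z hz hzm => ?_
  rw [hmax_comm] at hzm
  exact hC z ⟨hz.2, hz.1⟩ hzm

/-- The mean over the four corners minus g(M_{ij}) splits into the average of the vertical
differences at x_{i-1} and x_i plus the horizontal difference at height t_j. The points used stay
within 3h/2 + h/2 + h/2 of E, so the constants agree with those for `mu`. -/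
theorem abs_muStar_le (ha : 0 ≤ a) (hb : 0 ≤ b) (hj : HasJet (Omega K L) g gx gy gxx gxy gyy)
    (hxx : ∀ P ∈ Omega K L, |gxx P| ≤ a + b * l1 P E)
    (hyy : ∀ P ∈ Omega K L, |gyy P| ≤ a + b * l1 P E)
    (hg : ∀ P ∈ Omega K L, |g P| ≤ l1 P E ^ 2 * (a / 2 + b * l1 P E / 6))
    (hE : l1 (M K L i j) E ≤ 3 / 2 * hmax K L) :
    |muStar K L g i j| ≤ hmax K L ^ 2 * (11 / 8 * a + 19 / 16 * (b * hmax K L)) := by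
  have hh := hmax_pos K L
  set h := hmax K L with hh_def
  have hC : 0 ≤ a + b * (3 / 2 * h + h) := by positivity
  have hx := abs_mean_sub_le_fst (i := i) hj hC (L.mid_mem j) fun z hz hzm => by
    refine (hxx _ hz).trans ?_
    gcongr
    refine l1_le_of_fst hE (hzm.trans ?_); linarith
  have hk := step_le_hmax_left K L i
  have hk0 := K.step_nonneg i
  have key : ∀ x ∈ K.interval, |x - K.mid i| ≤ h / 2 →
      |(g (x, L.x (j - 1)) + g (x, L.x j)) / 2 - g (x, L.mid j)|
        ≤ h ^ 2 * (a + b * (3 / 2 * h + h)) / 8 := fun x hx hxm =>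
    abs_mean_sub_le_snd (j := j) hj hC hx fun z hz hzm => by
      refine (hyy _ hz).trans ?_
      gcongr
      refine (l1_le_of_snd (l1_le_of_fst hE hxm) hzm).trans (by linarith)
  have h1 := key (K.x (i - 1)) (K.x_mem _) (by
    rw [abs_le, K.mid_eq_sub, K.x_sub_one]; constructor <;> linarith)
  have h2 := key (K.x i) (K.x_mem _) (by
    rw [abs_le, K.mid_eq_sub]; constructor <;> linarith)
  have h0 := abs_g_M_le ha hb hg hE
  rw [abs_le] at hx h1 h2 h0 ⊢
  simp only [muStar, M, A] at *
  constructor <;> nlinarith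

end

/-! ### Splines as Bernstein-Bézier patches, and reproduction of quadratics. -/

section

/-! ### Linear combinations of B-splines -/

variable (K L : Knots)

/-- The linear combination of the B-splines with coefficients `m`. -/
def spline (m : ℤ → ℤ → ℝ) (p : ℝ × ℝ) : ℝ :=
  ∑ i ∈ Finset.Icc (0 : ℤ) (K.N + 1), ∑ j ∈ Finset.Icc (0 : ℤ) (L.N + 1),
    m i j * bspline K L i j p

/-- The value at the knot `x_{r-1}` of the univariate spline with coefficients `m`. -/
def Knots.interp (m : ℤ → ℝ) (r : ℤ) : ℝ := K.sig r * m (r - 1) + K.sig' r * m r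

/-- The Bernstein-Bézier coefficient of `spline K L m` at `A_{r-1,s-1}`. -/
def corner (m : ℤ → ℤ → ℝ) (r s : ℤ) : ℝ := K.interp (fun i => L.interp (m i) s) r

/-- The Bernstein-Bézier coefficient of `spline K L m` at `(s_r, y_{s-1})`. -/
def horEdge (m : ℤ → ℤ → ℝ) (r s : ℤ) : ℝ := L.interp (m r) s

/-- The Bernstein-Bézier coefficient of `spline K L m` at `(x_{r-1}, t_s)`. -/
def verEdge (m : ℤ → ℤ → ℝ) (r s : ℤ) : ℝ := K.interp (fun i => m i s) r

theorem Knots.sum_mul_knotVal (m : ℤ → ℝ) {k r : ℤ} (hk : k = r - 1) (h1 : 1 ≤ r)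
    (h2 : r ≤ K.N + 1) :
    ∑ i ∈ Finset.Icc (0 : ℤ) (K.N + 1), m i * K.knotVal i k = K.interp m r := by
  have : ∀ i, m i * K.knotVal i k
      = (if i = r - 1 then K.sig r * m (r - 1) else 0) + (if i = r then K.sig' r * m r else 0) := by
    intro i
    subst hk
    by_cases h : i = r
    · subst h
      rw [knotVal, if_pos rfl, if_neg (by omega), if_pos rfl]
      ring
    · by_cases h' : i = r - 1
      · rw [knotVal, if_neg (by omega), if_pos h'.symm, if_pos h', if_neg h, h', sub_add_cancel]
        ring
      · rw [knotVal, if_neg (by omega), if_neg (by omega), if_neg h, if_neg h']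
        simp
  simp only [this, Finset.sum_add_distrib, Finset.sum_ite_eq', Finset.mem_Icc]
  rw [if_pos (by omega), if_pos (by omega), interp]

/-- Holds because a patch is linear in its eight BB-coefficients at a fixed point. -/
theorem square_sum {ι : Type*} (s : Finset ι) (w a b c d e f g h : ι → ℝ) (u v : ℝ) :
    ∑ k ∈ s, w k * square (a k) (b k) (c k) (d k) (e k) (f k) (g k) (h k) u v
      = square (∑ k ∈ s, w k * a k) (∑ k ∈ s, w k * b k) (∑ k ∈ s, w k * c k)
        (∑ k ∈ s, w k * d k) (∑ k ∈ s, w k * e k) (∑ k ∈ s, w k * f k) (∑ k ∈ s, w k * g k)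
        (∑ k ∈ s, w k * h k) u v := by
  classical
  induction s using Finset.induction_on with
  | empty => simp [square, bernstein]
  | insert k s hk ih =>
    simp only [Finset.sum_insert hk, ih]
    simp only [square, bernstein]
    split_ifs <;> ring

/-- The open rectangle number `(r, s)`. -/
def openRect (r s : ℤ) : Set (ℝ × ℝ) := Ioo (K.x (r - 1)) (K.x r) ×ˢ Ioo (L.x (s - 1)) (L.x s)

theorem openRect_subset (r s : ℤ) : openRect K L r s ⊆ Omega K L := by
  rintro p ⟨⟨h1, h2⟩, h3, h4⟩
  have k1 := K.x_mem r
  have k2 := K.x_mem (r - 1)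
  have k3 := L.x_mem s
  have k4 := L.x_mem (s - 1)
  exact ⟨⟨k2.1.trans h1.le, h2.le.trans k1.2⟩, k4.1.trans h3.le, h4.le.trans k3.2⟩

/-- On an open rectangle all B-splines share the indices r, s, so the sum passes to the
BB-coefficients. There at most two values of i and two of j survive in each. -/
theorem spline_eq_square (m : ℤ → ℤ → ℝ) {r s : ℤ} (hr1 : 1 ≤ r) (hr2 : r ≤ K.N) (hs1 : 1 ≤ s)
    (hs2 : s ≤ L.N) {p : ℝ × ℝ} (hp : p ∈ openRect K L r s) :
    spline K L m p = square (corner K L m r s) (corner K L m (r + 1) s) (corner K L m r (s + 1))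
      (corner K L m (r + 1) (s + 1)) (horEdge L m r s) (horEdge L m r (s + 1)) (verEdge K m r s)
      (verEdge K m (r + 1) s) ((p.1 - K.x (r - 1)) / K.step r)
      ((p.2 - L.x (s - 1)) / L.step s) := by
  have hO := openRect_subset K L r s hp
  simp only [spline, bspline, if_pos hO, K.col_eq hr1 hr2 hp.1, L.col_eq hs1 hs2 hp.2]
  rw [← Finset.sum_product', square_sum]
  have hv : ∀ (k l r' s' : ℤ), k = r' - 1 → l = s' - 1 → 1 ≤ r' → r' ≤ K.N + 1 → 1 ≤ s' →
      s' ≤ L.N + 1 → ∑ x ∈ Finset.Icc (0 : ℤ) (K.N + 1) ×ˢ Finset.Icc (0 : ℤ) (L.N + 1),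
        m x.1 x.2 * (K.knotVal x.1 k * L.knotVal x.2 l) = corner K L m r' s' := by
    intro k l r' s' hk hl h1 h2 h3 h4
    rw [Finset.sum_product, corner, ← K.sum_mul_knotVal _ hk h1 h2]
    refine Finset.sum_congr rfl fun i _ => ?_
    rw [← L.sum_mul_knotVal _ hl h3 h4, Finset.sum_mul]
    exact Finset.sum_congr rfl fun j _ => by ring
  have hh : ∀ (l s' : ℤ), l = s' - 1 → 1 ≤ s' → s' ≤ L.N + 1 →
      ∑ x ∈ Finset.Icc (0 : ℤ) (K.N + 1) ×ˢ Finset.Icc (0 : ℤ) (L.N + 1),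
        m x.1 x.2 * (if r = x.1 then L.knotVal x.2 l else 0) = horEdge L m r s' := by
    intro l s' hl h3 h4
    rw [Finset.sum_product, horEdge, ← L.sum_mul_knotVal _ hl h3 h4]
    simp only [mul_ite, mul_zero]
    rw [Finset.sum_comm]
    refine Finset.sum_congr rfl fun j _ => ?_
    rw [Finset.sum_ite_eq, if_pos (Finset.mem_Icc.2 ⟨by omega, by omega⟩)]
  have hw : ∀ (k r' : ℤ), k = r' - 1 → 1 ≤ r' → r' ≤ K.N + 1 →
      ∑ x ∈ Finset.Icc (0 : ℤ) (K.N + 1) ×ˢ Finset.Icc (0 : ℤ) (L.N + 1),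
        m x.1 x.2 * (if s = x.2 then K.knotVal x.1 k else 0) = verEdge K m r' s := by
    intro k r' hk h1 h2
    rw [Finset.sum_product, verEdge, ← K.sum_mul_knotVal _ hk h1 h2]
    simp only [mul_ite, mul_zero]
    refine Finset.sum_congr rfl fun i _ => ?_
    rw [Finset.sum_ite_eq, if_pos (Finset.mem_Icc.2 ⟨by omega, by omega⟩)]
  rw [hv (r - 1) (s - 1) r s, hv r (s - 1) (r + 1) s, hv (r - 1) s r (s + 1),
    hv r s (r + 1) (s + 1), hh (s - 1) s, hh s (s + 1), hw (r - 1) r, hw r (r + 1)] <;> omega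

/-! ### Reproduction of quadratic polynomials -/

variable {K L}

theorem Knots.interp_add_of_eq {K : Knots} {m m₁ m₂ : ℤ → ℝ} (h : ∀ i, m i = m₁ i + m₂ i) (r : ℤ) :
    K.interp m r = K.interp m₁ r + K.interp m₂ r := by
  simp only [interp, h]; ring

theorem Knots.interp_blossom {K : Knots} (a b c : ℝ) {r : ℤ} (h1 : 1 ≤ r) (h2 : r ≤ K.N + 1) :
    K.interp (fun i => a + b * K.mid i + c * (K.x (i - 1) * K.x i)) r
      = a + b * K.x (r - 1) + c * K.x (r - 1) ^ 2 := by
  have e1 := K.sig_add_sig' h1 h2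
  have e2 := K.sig_mid h1 h2
  have e3 := K.sig_x_mul_x h1 h2
  rw [interp]
  linear_combination a * e1 + b * e2 + c * e3

variable {m m' : ℤ → ℤ → ℝ} {c₀ c₁ c₂ c₃ c₄ c₅ : ℝ} {r s : ℤ}

theorem horEdge_eq (hm : ∀ i j, m i j = blossom K L c₀ c₁ c₂ c₃ c₄ c₅ i j + m' i j)
    (h1 : 1 ≤ s) (h2 : s ≤ L.N + 1) :
    horEdge L m r s = c₀ + c₁ * K.mid r + c₃ * (K.x (r - 1) * K.x r)
      + (c₂ + c₄ * K.mid r) * L.x (s - 1) + c₅ * L.x (s - 1) ^ 2 + horEdge L m' r s := by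
  rw [horEdge, Knots.interp_add_of_eq (hm r)]
  congr 1
  rw [← Knots.interp_blossom _ _ _ h1 h2]
  congr 1
  funext j
  simp only [blossom]; ring

theorem verEdge_eq (hm : ∀ i j, m i j = blossom K L c₀ c₁ c₂ c₃ c₄ c₅ i j + m' i j)
    (h1 : 1 ≤ r) (h2 : r ≤ K.N + 1) :
    verEdge K m r s = c₀ + c₂ * L.mid s + c₅ * (L.x (s - 1) * L.x s)
      + (c₁ + c₄ * L.mid s) * K.x (r - 1) + c₃ * K.x (r - 1) ^ 2 + verEdge K m' r s := by
  rw [verEdge, Knots.interp_add_of_eq (fun i => hm i s)]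
  congr 1
  rw [← Knots.interp_blossom _ _ _ h1 h2]
  congr 1
  funext j
  simp only [blossom]; ring

/-- As functions of the column index, the horizontal edge coefficients again have blossom form, now
in x, so `interp_blossom` applies a second time. -/
theorem corner_eq (hm : ∀ i j, m i j = blossom K L c₀ c₁ c₂ c₃ c₄ c₅ i j + m' i j)
    (h1 : 1 ≤ r) (h2 : r ≤ K.N + 1) (h3 : 1 ≤ s) (h4 : s ≤ L.N + 1) :
    corner K L m r s = c₀ + c₂ * L.x (s - 1) + c₅ * L.x (s - 1) ^ 2
      + (c₁ + c₄ * L.x (s - 1)) * K.x (r - 1) + c₃ * K.x (r - 1) ^ 2 + corner K L m' r s := by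
  refine (Knots.interp_add_of_eq (fun i => horEdge_eq (r := i) hm h3 h4) r).trans ?_
  refine congrArg₂ _ ?_ rfl
  rw [← Knots.interp_blossom _ _ _ h1 h2]
  congr 1
  funext j
  ring

theorem Knots.abs_interp_le {K : Knots} {m : ℤ → ℝ} {B : ℝ} {r : ℤ} (h1 : 1 ≤ r)
    (h2 : r ≤ K.N + 1) (hm : |m (r - 1)| ≤ B) (hm' : |m r| ≤ B) : |K.interp m r| ≤ B := by
  have e1 := K.sig_add_sig' h1 h2
  calc |K.interp m r| ≤ K.sig r * |m (r - 1)| + K.sig' r * |m r| := by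
        rw [interp]
        refine (abs_add_le _ _).trans ?_
        rw [abs_mul, abs_mul, abs_of_nonneg (K.sig_nonneg r), abs_of_nonneg (K.sig'_nonneg r)]
    _ ≤ K.sig r * B + K.sig' r * B := by
        have := K.sig_nonneg r
        have := K.sig'_nonneg r
        gcongr
    _ = B := by rw [← add_mul, e1, one_mul]

/-! ### The four polynomial pieces on the unit square -/

/-- The two corners opposite the base do not occur, and the opposite side enters only through its
midpoint coefficient, via the center. This locality, shared by the other three pieces, keeps all
relevant functionals within 3h/2 of E. -/
theorem square_south (sw se nw ne eS eN eW eE : ℝ) {u v : ℝ} (h1 : v ≤ u) (h2 : u + v ≤ 1) :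
    square sw se nw ne eS eN eW eE u v = quad sw (2 * (eS - sw)) (2 * (eW - sw))
      (sw - 2 * eS + se) (2 * (sw - se + eE - eW)) (sw + se + eN - eS - eW - eE) (u, v) := by
  simp only [square, bernstein, quad, if_pos h1, if_pos h2]; ring

theorem square_west (sw se nw ne eS eN eW eE : ℝ) {u v : ℝ} (h1 : u < v) (h2 : u + v ≤ 1) :
    square sw se nw ne eS eN eW eE u v = quad sw (2 * (eS - sw)) (2 * (eW - sw))
      (sw + nw + eE - eW - eS - eN) (2 * (sw - nw + eN - eS)) (sw - 2 * eW + nw) (u, v) := by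
  simp only [square, bernstein, quad, if_neg h1.not_ge, if_pos h2]; ring

theorem square_east (sw se nw ne eS eN eW eE : ℝ) {u v : ℝ} (h1 : v ≤ u) (h2 : 1 < u + v) :
    square sw se nw ne eS eN eW eE u v = quad (ne + eW + eS - eN - eE)
      (2 * (eE + eN - ne - eW)) (2 * (eE - ne + eN - eS)) (se + ne + eW - eE - eS - eN)
      (2 * (ne - se + eS - eN)) (se - 2 * eE + ne) (u, v) := by
  simp only [square, bernstein, quad, if_pos h1, if_neg h2.not_ge]; ring

theorem square_north (sw se nw ne eS eN eW eE : ℝ) {u v : ℝ} (h1 : u < v) (h2 : 1 < u + v) :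
    square sw se nw ne eS eN eW eE u v = quad (ne + eW + eS - eN - eE)
      (2 * (eN - ne + eE - eW)) (2 * (eE + eN - ne - eS)) (nw - 2 * eN + ne)
      (2 * (ne - nw + eW - eE)) (nw + ne + eS - eN - eW - eE) (u, v) := by
  simp only [square, bernstein, quad, if_neg h1.not_ge, if_neg h2.not_ge]; ring

/-- Only the coefficients of order two are kept explicit, since the second derivatives see nothing
else. -/
theorem exists_quad_rescale (b₀ b₁ b₂ b₃ b₄ b₅ x₀ y₀ H H' : ℝ) :
    ∃ d₀ d₁ d₂ : ℝ, ∀ p : ℝ × ℝ, quad b₀ b₁ b₂ b₃ b₄ b₅ ((p.1 - x₀) / H, (p.2 - y₀) / H')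
      = quad d₀ d₁ d₂ (b₃ / (H * H)) (b₄ / (H * H')) (b₅ / (H' * H')) p :=
  ⟨quad b₀ b₁ b₂ b₃ b₄ b₅ (-x₀ / H, -y₀ / H'),
    b₁ / H - 2 * b₃ * x₀ / (H * H) - b₄ * y₀ / (H * H'),
    b₂ / H' - 2 * b₅ * y₀ / (H' * H') - b₄ * x₀ / (H * H'), fun p => by
      simp only [quad]; ring⟩

/-! ### The interior of a triangle -/

/-- A nonzero linear form is an open map, so the interior of a closed half-plane is the open
half-plane. -/
theorem lt_of_mem_interior_triangle {P Q R p : ℝ × ℝ}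
    (hp : p ∈ interior (convexHull ℝ {P, Q, R})) {α β c : ℝ} (hαβ : α ≠ 0 ∨ β ≠ 0)
    (hP : c ≤ α * P.1 + β * P.2) (hQ : c ≤ α * Q.1 + β * Q.2) (hR : c ≤ α * R.1 + β * R.2) :
    c < α * p.1 + β * p.2 := by
  have hsub : convexHull ℝ {P, Q, R} ⊆ lin α β ⁻¹' Ici c := by
    refine convexHull_min ?_ ((convex_Ici c).linear_preimage (lin α β).toLinearMap)
    rintro z (rfl | rfl | rfl) <;> simpa
  have hne : lin α β ≠ 0 := fun h => by
    have h1 := congrArg (fun φ => φ (1, 0)) h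
    have h2 := congrArg (fun φ => φ (0, 1)) h
    simp at h1 h2
    tauto
  have := interior_mono hsub hp
  rw [← ((lin α β).isOpenMap_of_ne_zero hne).preimage_interior_eq_interior_preimage
    (lin α β).continuous, interior_Ici] at this
  simpa using this

end

/-! ### From BB-coefficients to second derivatives on a triangle. -/

section

variable {K L : Knots} {m m' : ℤ → ℤ → ℝ} {c₀ c₁ c₂ c₃ c₄ c₅ : ℝ} {r s : ℤ}

/-- On the interior of `T`, every spline is a quadratic polynomial, and its second derivatives are
controlled by the deviation of its coefficients from those of a quadratic polynomial, near `E`. -/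
def CellEstimate (K L : Knots) (T : Set (ℝ × ℝ)) (E : ℝ × ℝ) : Prop :=
  E ∈ Omega K L ∧ (∀ P ∈ interior T, P ∈ Omega K L ∧ l1 P E ≤ 3 / 2 * hmax K L) ∧
  ∀ (m m' : ℤ → ℤ → ℝ) (c₀ c₁ c₂ c₃ c₄ c₅ B : ℝ),
    (∀ i j, m i j = blossom K L c₀ c₁ c₂ c₃ c₄ c₅ i j + m' i j) →
    (∀ i j, l1 (M K L i j) E ≤ 3 / 2 * hmax K L → |m' i j| ≤ B) →
    ∃ d₀ d₁ d₂ d₃ d₄ d₅ : ℝ,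
      (∀ P ∈ interior T, spline K L m P = quad d₀ d₁ d₂ d₃ d₄ d₅ P) ∧
      |2 * c₃ - 2 * d₃| ≤ 12 * B / hmin K L ^ 2 ∧ |c₄ - d₄| ≤ 12 * B / hmin K L ^ 2 ∧
      |2 * c₅ - 2 * d₅| ≤ 12 * B / hmin K L ^ 2

theorem Knots.abs_mid_sub_mid_pred_le {h : ℝ} (hh : ∀ i, K.step i ≤ h) (i : ℤ) :
    |K.mid (i - 1) - K.mid i| ≤ h := by
  have h1 := K.mid_sub_mid i
  have := hh i
  have := hh (i - 1)
  have := K.step_nonneg i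
  have := K.step_nonneg (i - 1)
  rw [abs_le]; constructor <;> linarith

theorem Knots.abs_mid_succ_sub_mid_le {h : ℝ} (hh : ∀ i, K.step i ≤ h) (i : ℤ) :
    |K.mid (i + 1) - K.mid i| ≤ h := by
  have := K.abs_mid_sub_mid_pred_le hh (i + 1)
  rwa [add_sub_cancel_right, abs_sub_comm] at this

theorem Knots.abs_mid_sub_x_le {h : ℝ} (hh : ∀ i, K.step i ≤ h) (i : ℤ) :
    |K.mid i - K.x i| ≤ h / 2 := by
  have h1 := K.mid_eq_sub i
  have := hh i
  have := K.step_nonneg i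
  rw [abs_le]; constructor <;> linarith

theorem Knots.abs_mid_sub_x_pred_le {h : ℝ} (hh : ∀ i, K.step i ≤ h) (i : ℤ) :
    |K.mid i - K.x (i - 1)| ≤ h / 2 := by
  have h1 := K.mid_eq_sub i
  have h2 := K.x_sub_one i
  have := hh i
  have := K.step_nonneg i
  rw [abs_le]; constructor <;> linarith

theorem Knots.abs_mid_succ_sub_x_le {h : ℝ} (hh : ∀ i, K.step i ≤ h) (i : ℤ) :
    |K.mid (i + 1) - K.x i| ≤ h / 2 := by
  have := K.abs_mid_sub_x_pred_le hh (i + 1)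
  rwa [add_sub_cancel_right] at this

theorem Knots.abs_mid_pred_sub_x_pred_le {h : ℝ} (hh : ∀ i, K.step i ≤ h) (i : ℤ) :
    |K.mid (i - 1) - K.x (i - 1)| ≤ h / 2 := K.abs_mid_sub_x_le hh (i - 1)

theorem Knots.abs_mid_succ_sub_x_pred_le {h : ℝ} (hh : ∀ i, K.step i ≤ h) (i : ℤ) :
    |K.mid (i + 1) - K.x (i - 1)| ≤ 3 / 2 * h := by
  have h1 := abs_le.1 (K.abs_mid_succ_sub_x_le hh i)
  have h2 := K.x_sub_one i
  have := hh i
  have := K.step_nonneg i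
  rw [abs_le]; constructor <;> linarith

theorem Knots.abs_mid_pred_sub_x_le {h : ℝ} (hh : ∀ i, K.step i ≤ h) (i : ℤ) :
    |K.mid (i - 1) - K.x i| ≤ 3 / 2 * h := by
  have h1 := abs_le.1 (K.abs_mid_pred_sub_x_pred_le hh i)
  have h2 := K.x_sub_one i
  have := hh i
  have := K.step_nonneg i
  rw [abs_le]; constructor <;> linarith

/-- The pure derivatives double the coefficients of u² and v², while the mixed one does not double
that of uv. Writing the latter error as 2e₄ gives all three the form 2e divided by two steps, at
most 2·6B/δ². -/
theorem exists_quad_of_piece {U : Set (ℝ × ℝ)} {B : ℝ} (hB : 0 ≤ B) (hr1 : 1 ≤ r)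
    (hr2 : r ≤ K.N) (hs1 : 1 ≤ s) (hs2 : s ≤ L.N) {b₀ b₁ b₂ b₃ b₄ b₅ e₃ e₄ e₅ : ℝ}
    (hU : ∀ p ∈ U, spline K L m p = quad b₀ b₁ b₂ b₃ b₄ b₅
      ((p.1 - K.x (r - 1)) / K.step r, (p.2 - L.x (s - 1)) / L.step s))
    (h3 : b₃ = c₃ * (K.step r * K.step r) + e₃) (he3 : |e₃| ≤ 6 * B)
    (h4 : b₄ = c₄ * (K.step r * L.step s) + 2 * e₄) (he4 : |e₄| ≤ 6 * B)
    (h5 : b₅ = c₅ * (L.step s * L.step s) + e₅) (he5 : |e₅| ≤ 6 * B) :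
    ∃ d₀ d₁ d₂ d₃ d₄ d₅ : ℝ,
      (∀ P ∈ U, spline K L m P = quad d₀ d₁ d₂ d₃ d₄ d₅ P) ∧
      |2 * c₃ - 2 * d₃| ≤ 12 * B / hmin K L ^ 2 ∧ |c₄ - d₄| ≤ 12 * B / hmin K L ^ 2 ∧
      |2 * c₅ - 2 * d₅| ≤ 12 * B / hmin K L ^ 2 := by
  have hδ := hmin_pos K L
  have hH := hmin_le_step_left K L hr1 hr2
  have hH' := hmin_le_step_right K L hs1 hs2
  have key : ∀ x y e : ℝ, hmin K L ≤ x → hmin K L ≤ y → |e| ≤ 6 * B →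
      |2 * e / (x * y)| ≤ 12 * B / hmin K L ^ 2 := by
    intro x y e hx hy he
    have : 0 < x * y := mul_pos (hδ.trans_le hx) (hδ.trans_le hy)
    rw [abs_div, abs_of_pos this, abs_mul, abs_two, sq]
    exact div_le_div₀ (by positivity) (by linarith) (by positivity)
      (mul_le_mul hx hy hδ.le (hδ.le.trans hx))
  have p1 : K.step r ≠ 0 := (hδ.trans_le hH).ne'
  have p2 : L.step s ≠ 0 := (hδ.trans_le hH').ne'
  obtain ⟨d₀, d₁, d₂, hd⟩ := exists_quad_rescale b₀ b₁ b₂ b₃ b₄ b₅ (K.x (r - 1)) (L.x (s - 1))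
    (K.step r) (L.step s)
  refine ⟨d₀, d₁, d₂, _, _, _, fun P hP => (hU P hP).trans (hd P), ?_, ?_, ?_⟩
  · rw [abs_sub_comm, show 2 * (b₃ / (K.step r * K.step r)) - 2 * c₃
      = 2 * e₃ / (K.step r * K.step r) by rw [h3]; field_simp; ring]
    exact key _ _ _ hH hH he3
  · rw [abs_sub_comm, show b₄ / (K.step r * L.step s) - c₄
      = 2 * e₄ / (K.step r * L.step s) by rw [h4]; field_simp; ring]
    exact key _ _ _ hH hH' he4
  · rw [abs_sub_comm, show 2 * (b₅ / (L.step s * L.step s)) - 2 * c₅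
      = 2 * e₅ / (L.step s * L.step s) by rw [h5]; field_simp; ring]
    exact key _ _ _ hH' hH' he5

/-- The three sign patterns are those of the second derivative across the base, along the base, and
mixed. -/
theorem abs_six_le {B a b c d e f : ℝ} (ha : |a| ≤ B) (hb : |b| ≤ B) (hc : |c| ≤ B) (hd : |d| ≤ B)
    (he : |e| ≤ B) (hf : |f| ≤ B) :
    |a + b + c - d - e - f| ≤ 6 * B ∧ |a - 2 * b + c| ≤ 6 * B ∧ |a - b + c - d| ≤ 6 * B := by
  have hB := (abs_nonneg a).trans ha
  simp only [abs_le] at *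
  refine ⟨⟨?_, ?_⟩, ⟨?_, ?_⟩, ?_, ?_⟩ <;> linarith

theorem horEdge_blossom (hs1 : 1 ≤ s) (hs2 : s ≤ L.N)
    (hm : ∀ i j, m i j = blossom K L c₀ c₁ c₂ c₃ c₄ c₅ i j + m' i j) {X Y H H' : ℝ}
    (hX : K.x (r - 1) = X) (hY : L.x (s - 1) = Y) (hH : K.step r = H) (hH' : L.step s = H') :
    horEdge L m r s = c₀ + c₁ * (X + H / 2) + c₃ * (X * (X + H))
      + (c₂ + c₄ * (X + H / 2)) * Y + c₅ * Y ^ 2 + horEdge L m' r s ∧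
    horEdge L m r (s + 1) = c₀ + c₁ * (X + H / 2) + c₃ * (X * (X + H))
      + (c₂ + c₄ * (X + H / 2)) * (Y + H') + c₅ * (Y + H') ^ 2 + horEdge L m' r (s + 1) := by
  have e1 := K.x_sub_one r
  have e2 := L.x_sub_one s
  have e3 := K.mid_eq_sub r
  rw [hX, hH] at e1
  rw [hY, hH'] at e2
  rw [horEdge_eq hm hs1 (by omega), horEdge_eq hm (by omega) (by omega), add_sub_cancel_right, hX,
    hY, e3, hH, show K.x r = X + H by linarith, show L.x s = Y + H' by linarith]
  constructor <;> ring

theorem verEdge_blossom (hr1 : 1 ≤ r) (hr2 : r ≤ K.N)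
    (hm : ∀ i j, m i j = blossom K L c₀ c₁ c₂ c₃ c₄ c₅ i j + m' i j) {X Y H H' : ℝ}
    (hX : K.x (r - 1) = X) (hY : L.x (s - 1) = Y) (hH : K.step r = H) (hH' : L.step s = H') :
    verEdge K m r s = c₀ + c₂ * (Y + H' / 2) + c₅ * (Y * (Y + H'))
      + (c₁ + c₄ * (Y + H' / 2)) * X + c₃ * X ^ 2 + verEdge K m' r s ∧
    verEdge K m (r + 1) s = c₀ + c₂ * (Y + H' / 2) + c₅ * (Y * (Y + H'))
      + (c₁ + c₄ * (Y + H' / 2)) * (X + H) + c₃ * (X + H) ^ 2 + verEdge K m' (r + 1) s := by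
  have e1 := K.x_sub_one r
  have e2 := L.x_sub_one s
  have e3 := L.mid_eq_sub s
  rw [hX, hH] at e1
  rw [hY, hH'] at e2
  rw [verEdge_eq hm hr1 (by omega), verEdge_eq hm (by omega) (by omega), add_sub_cancel_right, hX,
    hY, e3, hH', show K.x r = X + H by linarith, show L.x s = Y + H' by linarith]
  constructor <;> ring

theorem corner_blossom (hr1 : 1 ≤ r) (hr2 : r ≤ K.N) (hs1 : 1 ≤ s) (hs2 : s ≤ L.N)
    (hm : ∀ i j, m i j = blossom K L c₀ c₁ c₂ c₃ c₄ c₅ i j + m' i j) {X Y H H' : ℝ}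
    (hX : K.x (r - 1) = X) (hY : L.x (s - 1) = Y) (hH : K.step r = H) (hH' : L.step s = H') :
    corner K L m r s = quad c₀ c₁ c₂ c₃ c₄ c₅ (X, Y) + corner K L m' r s ∧
    corner K L m (r + 1) s = quad c₀ c₁ c₂ c₃ c₄ c₅ (X + H, Y) + corner K L m' (r + 1) s ∧
    corner K L m r (s + 1) = quad c₀ c₁ c₂ c₃ c₄ c₅ (X, Y + H') + corner K L m' r (s + 1) ∧
    corner K L m (r + 1) (s + 1)
      = quad c₀ c₁ c₂ c₃ c₄ c₅ (X + H, Y + H') + corner K L m' (r + 1) (s + 1) := by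
  have e1 := K.x_sub_one r
  have e2 := L.x_sub_one s
  rw [hX, hH] at e1
  rw [hY, hH'] at e2
  rw [corner_eq hm, corner_eq hm, corner_eq hm, corner_eq hm, add_sub_cancel_right,
    add_sub_cancel_right, hX, hY, show K.x r = X + H by linarith, show L.x s = Y + H' by linarith]
  · simp only [quad]
    refine ⟨?_, ?_, ?_, ?_⟩ <;> ring
  all_goals omega

/-- The interior of a triangle of the rectangle number `(r, s)` lies in the open rectangle. -/
theorem mem_openRect_of_triangle {P Q : ℝ × ℝ} (hr1 : 1 ≤ r) (hr2 : r ≤ K.N) (hs1 : 1 ≤ s)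
    (hs2 : s ≤ L.N) (hP : P ∈ Icc (K.x (r - 1)) (K.x r) ×ˢ Icc (L.x (s - 1)) (L.x s))
    (hQ : Q ∈ Icc (K.x (r - 1)) (K.x r) ×ˢ Icc (L.x (s - 1)) (L.x s)) {p : ℝ × ℝ}
    (hp : p ∈ interior (convexHull ℝ {P, Q, M K L r s})) : p ∈ openRect K L r s := by
  have e1 := K.x_sub_one r
  have e2 := L.x_sub_one s
  have e3 := K.mid_eq_sub r
  have e4 := L.mid_eq_sub s
  have p1 := K.step_pos hr1 hr2
  have p2 := L.step_pos hs1 hs2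
  obtain ⟨⟨P1, P2⟩, P3, P4⟩ := hP
  obtain ⟨⟨Q1, Q2⟩, Q3, Q4⟩ := hQ
  have k1 := lt_of_mem_interior_triangle (α := 1) (β := 0) (c := K.x (r - 1)) hp (by simp)
    (by linarith) (by linarith) (by simp only [M]; linarith)
  have k2 := lt_of_mem_interior_triangle (α := -1) (β := 0) (c := -K.x r) hp (by simp)
    (by linarith) (by linarith) (by simp only [M]; linarith)
  have k3 := lt_of_mem_interior_triangle (α := 0) (β := 1) (c := L.x (s - 1)) hp (by simp)
    (by linarith) (by linarith) (by simp only [M]; linarith)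
  have k4 := lt_of_mem_interior_triangle (α := 0) (β := -1) (c := -L.x s) hp (by simp)
    (by linarith) (by linarith) (by simp only [M]; linarith)
  exact ⟨⟨by linarith, by linarith⟩, by linarith, by linarith⟩

/-- From the midpoint of a side, the displacement is at most h/2 along the side and h across it. -/
theorem l1_le_of_mem_openRect {p : ℝ × ℝ} (hp : p ∈ openRect K L r s) :
    l1 p (K.mid r, L.x (s - 1)) ≤ 3 / 2 * hmax K L ∧ l1 p (K.mid r, L.x s) ≤ 3 / 2 * hmax K L ∧
    l1 p (K.x (r - 1), L.mid s) ≤ 3 / 2 * hmax K L ∧ l1 p (K.x r, L.mid s) ≤ 3 / 2 * hmax K L := by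
  obtain ⟨⟨h1, h2⟩, h3, h4⟩ := hp
  have e1 := K.x_sub_one r
  have e2 := L.x_sub_one s
  have e3 := K.mid_eq_sub r
  have e4 := L.mid_eq_sub s
  have k1 := step_le_hmax_left K L r
  have k2 := step_le_hmax_right K L s
  have a1 : |p.1 - K.mid r| ≤ hmax K L / 2 := by rw [abs_le]; constructor <;> linarith
  have a2 : |p.1 - K.x r| ≤ hmax K L := by rw [abs_le]; constructor <;> linarith
  have a3 : |p.1 - K.x (r - 1)| ≤ hmax K L := by rw [abs_le]; constructor <;> linarith
  have a4 : |p.2 - L.mid s| ≤ hmax K L / 2 := by rw [abs_le]; constructor <;> linarith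
  have a5 : |p.2 - L.x s| ≤ hmax K L := by rw [abs_le]; constructor <;> linarith
  have a6 : |p.2 - L.x (s - 1)| ≤ hmax K L := by rw [abs_le]; constructor <;> linarith
  simp only [l1]
  refine ⟨?_, ?_, ?_, ?_⟩ <;> linarith

end

/-! ### The cell estimate for the four triangles of a rectangle. -/

section

variable {K L : Knots} {m m' : ℤ → ℤ → ℝ} {c₀ c₁ c₂ c₃ c₄ c₅ : ℝ} {r s : ℤ}

theorem abs_corner_le {B : ℝ} (hr1 : 1 ≤ r) (hr2 : r ≤ K.N + 1) (hs1 : 1 ≤ s) (hs2 : s ≤ L.N + 1)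
    (h1 : |m (r - 1) (s - 1)| ≤ B) (h2 : |m (r - 1) s| ≤ B) (h3 : |m r (s - 1)| ≤ B)
    (h4 : |m r s| ≤ B) : |corner K L m r s| ≤ B :=
  Knots.abs_interp_le hr1 hr2 (Knots.abs_interp_le hs1 hs2 h1 h2) (Knots.abs_interp_le hs1 hs2 h3 h4)

/-- Bounds for the coefficients along a horizontal line and on the two adjacent vertical sides. -/
theorem abs_coeffs_le_of_horizontal {B y : ℝ} (hr1 : 1 ≤ r) (hr2 : r ≤ K.N) {q : ℤ} (hq1 : 1 ≤ q)
    (hq2 : q ≤ L.N + 1) (hm : ∀ i j, l1 (M K L i j) (K.mid r, y) ≤ 3 / 2 * hmax K L → |m i j| ≤ B)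
    (h1 : |L.mid (q - 1) - y| ≤ hmax K L / 2) (h2 : |L.mid q - y| ≤ hmax K L / 2)
    (hs : s = q - 1 ∨ s = q) :
    |corner K L m r q| ≤ B ∧ |corner K L m (r + 1) q| ≤ B ∧ |horEdge L m r q| ≤ B ∧
      |verEdge K m r s| ≤ B ∧ |verEdge K m (r + 1) s| ≤ B := by
  have hh := hmax_pos K L
  have k1 := K.abs_mid_sub_mid_pred_le (step_le_hmax_left K L) r
  have k2 := K.abs_mid_succ_sub_mid_le (step_le_hmax_left K L) r
  have k3 : |K.mid r - K.mid r| ≤ hmax K L := by simp [hh.le]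
  -- The columns r-1, r, r+1 are within h of s_r and the rows q-1, q within h/2 of the line, for a
  -- total of 3h/2.
  have key : ∀ i, |K.mid i - K.mid r| ≤ hmax K L → |m i (q - 1)| ≤ B ∧ |m i q| ≤ B := fun i hi =>
    ⟨hm _ _ ((add_le_add hi h1).trans (by linarith)),
      hm _ _ ((add_le_add hi h2).trans (by linarith))⟩
  have key' : ∀ i, |K.mid i - K.mid r| ≤ hmax K L → |m i s| ≤ B := fun i hi => by
    rcases hs with rfl | rfl
    · exact (key i hi).1
    · exact (key i hi).2
  have a1 := key _ k1
  have a2 := key _ k2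
  have a3 := key _ k3
  exact ⟨abs_corner_le hr1 (by omega) hq1 hq2 a1.1 a1.2 a3.1 a3.2,
    abs_corner_le (by omega) (by omega) hq1 hq2 (by rw [add_sub_cancel_right]; exact a3.1)
      (by rw [add_sub_cancel_right]; exact a3.2) a2.1 a2.2,
    Knots.abs_interp_le hq1 hq2 a3.1 a3.2,
    Knots.abs_interp_le hr1 (by omega) (key' _ k1) (key' _ k3),
    Knots.abs_interp_le (by omega) (by omega) (by rw [add_sub_cancel_right]; exact key' _ k3)
      (key' _ k2)⟩

/-- Bounds for the coefficients along a vertical line and on the two adjacent horizontal sides. -/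
theorem abs_coeffs_le_of_vertical {B x : ℝ} (hs1 : 1 ≤ s) (hs2 : s ≤ L.N) {q : ℤ} (hq1 : 1 ≤ q)
    (hq2 : q ≤ K.N + 1) (hm : ∀ i j, l1 (M K L i j) (x, L.mid s) ≤ 3 / 2 * hmax K L → |m i j| ≤ B)
    (h1 : |K.mid (q - 1) - x| ≤ hmax K L / 2) (h2 : |K.mid q - x| ≤ hmax K L / 2)
    (hr : r = q - 1 ∨ r = q) :
    |corner K L m q s| ≤ B ∧ |corner K L m q (s + 1)| ≤ B ∧ |verEdge K m q s| ≤ B ∧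
      |horEdge L m r s| ≤ B ∧ |horEdge L m r (s + 1)| ≤ B := by
  have hh := hmax_pos K L
  have k1 := L.abs_mid_sub_mid_pred_le (step_le_hmax_right K L) s
  have k2 := L.abs_mid_succ_sub_mid_le (step_le_hmax_right K L) s
  have k3 : |L.mid s - L.mid s| ≤ hmax K L := by simp [hh.le]
  have key : ∀ j, |L.mid j - L.mid s| ≤ hmax K L → |m (q - 1) j| ≤ B ∧ |m q j| ≤ B := fun i hi =>
    ⟨hm _ _ ((add_le_add h1 hi).trans (by linarith)),
      hm _ _ ((add_le_add h2 hi).trans (by linarith))⟩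
  have key' : ∀ j, |L.mid j - L.mid s| ≤ hmax K L → |m r j| ≤ B := fun i hi => by
    rcases hr with rfl | rfl
    · exact (key i hi).1
    · exact (key i hi).2
  have a1 := key _ k1
  have a2 := key _ k2
  have a3 := key _ k3
  exact ⟨abs_corner_le hq1 hq2 hs1 (by omega) a1.1 a3.1 a1.2 a3.2,
    abs_corner_le hq1 hq2 (by omega) (by omega) (by rw [add_sub_cancel_right]; exact a3.1)
      a2.1 (by rw [add_sub_cancel_right]; exact a3.2) a2.2,
    Knots.abs_interp_le hq1 hq2 a3.1 a3.2,
    Knots.abs_interp_le hs1 (by omega) (key' _ k1) (key' _ k3),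
    Knots.abs_interp_le (by omega) (by omega) (by rw [add_sub_cancel_right]; exact key' _ k3)
      (key' _ k2)⟩

theorem l1_mid_left {y e : ℝ} {j : ℤ} (h : |L.mid j - y| ≤ e) :
    l1 (M K L r j) (K.mid r, y) ≤ e := by
  simpa [l1, M] using h

theorem l1_mid_right {x e : ℝ} {i : ℤ} (h : |K.mid i - x| ≤ e) :
    l1 (M K L i s) (x, L.mid s) ≤ e := by
  simpa [l1, M] using h

theorem cellEstimate_south (hr1 : 1 ≤ r) (hr2 : r ≤ K.N) (hs1 : 1 ≤ s) (hs2 : s ≤ L.N) :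
    CellEstimate K L (convexHull ℝ {A K L (r - 1) (s - 1), A K L r (s - 1), M K L r s})
      (K.mid r, L.x (s - 1)) := by
  have hH := K.step_pos hr1 hr2
  have hH' := L.step_pos hs1 hs2
  have hHH := mul_pos hH hH'
  have ex := K.x_sub_one r
  have ey := L.x_sub_one s
  have mx := K.mid_eq_sub r
  have my := L.mid_eq_sub s
  have hrect := fun p hp => mem_openRect_of_triangle (P := A K L (r - 1) (s - 1))
    (Q := A K L r (s - 1)) (p := p) hr1 hr2 hs1 hs2
    (by constructor <;> constructor <;> simp only [A] <;> linarith)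
    (by constructor <;> constructor <;> simp only [A] <;> linarith) hp
  have hdiag : ∀ p ∈ interior (convexHull ℝ {A K L (r - 1) (s - 1), A K L r (s - 1), M K L r s}),
      (p.2 - L.x (s - 1)) / L.step s ≤ (p.1 - K.x (r - 1)) / K.step r := by
    intro p hp
    -- The linear form is constant on the diagonal from the lower left corner; the base and the
    -- center lie on one closed side of it. The form in `hdiag'` does the same for the other
    -- diagonal.
    have t := lt_of_mem_interior_triangle (α := L.step s) (β := -K.step r)
      (c := L.step s * K.x (r - 1) - K.step r * L.x (s - 1)) hp (Or.inl hH'.ne')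
      (by simp only [A, ex, ey]; linarith) (by simp only [A, ex, ey]; linarith)
      (by simp only [M, mx, my, ex, ey]; linarith)
    rw [div_le_div_iff₀ hH' hH]
    linarith
  have hdiag' : ∀ p ∈ interior (convexHull ℝ {A K L (r - 1) (s - 1), A K L r (s - 1), M K L r s}),
      (p.1 - K.x (r - 1)) / K.step r + (p.2 - L.x (s - 1)) / L.step s ≤ 1 := by
    intro p hp
    have t := lt_of_mem_interior_triangle (α := -L.step s) (β := -K.step r)
      (c := -(L.step s * K.x r + K.step r * L.x (s - 1))) hp (Or.inl (neg_ne_zero.2 hH'.ne'))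
      (by simp only [A, ex, ey]; linarith) (by simp only [A, ey]; linarith)
      (by simp only [M, mx, my, ey]; linarith)
    rw [div_add_div _ _ hH.ne' hH'.ne', div_le_one (mul_pos hH hH'), ex]
    linarith
  refine ⟨⟨K.mid_mem r, L.x_mem _⟩, fun P hP => ⟨openRect_subset K L r s (hrect P hP),
    (l1_le_of_mem_openRect (hrect P hP)).1⟩, fun m m' c₀ c₁ c₂ c₃ c₄ c₅ B hm hm' => ?_⟩
  have hx := step_le_hmax_left K L
  have hy := step_le_hmax_right K L
  have hh := hmax_pos K L
  obtain ⟨b1, b2, b3, b4, b5⟩ := abs_coeffs_le_of_horizontal (s := s) hr1 hr2 hs1 (by omega) hm'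
    (L.abs_mid_pred_sub_x_pred_le hy s) (L.abs_mid_sub_x_pred_le hy s) (Or.inr rfl)
  -- The side opposite E involves rows s and s+1, up to 3h/2 away, but only the column of E itself,
  -- so the radius still suffices.
  have b6 : |horEdge L m' r (s + 1)| ≤ B := Knots.abs_interp_le (by omega) (by omega)
    (by rw [add_sub_cancel_right]
        exact hm' _ _ (l1_mid_left ((L.abs_mid_sub_x_pred_le hy s).trans (by linarith))))
    (hm' _ _ (l1_mid_left (L.abs_mid_succ_sub_x_pred_le hy s)))
  obtain ⟨f1, f2, f3, f4⟩ := corner_blossom hr1 hr2 hs1 hs2 hm rfl rfl rfl rfl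
  obtain ⟨f5, f6⟩ := horEdge_blossom (r := r) hs1 hs2 hm rfl rfl rfl rfl
  obtain ⟨f7, f8⟩ := verEdge_blossom (s := s) hr1 hr2 hm rfl rfl rfl rfl
  refine exists_quad_of_piece ((abs_nonneg _).trans b1) hr1 hr2 hs1 hs2
    (fun p hp => (spline_eq_square K L m hr1 hr2 hs1 hs2 (hrect p hp)).trans
      (square_south _ _ _ _ _ _ _ _ (hdiag p hp) (hdiag' p hp)))
    (e₃ := corner K L m' r s - 2 * horEdge L m' r s + corner K L m' (r + 1) s) ?_
    (abs_six_le b1 b3 b2 b1 b1 b1).2.1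
    (e₄ := corner K L m' r s - corner K L m' (r + 1) s + verEdge K m' (r + 1) s
      - verEdge K m' r s) ?_
    (abs_six_le b1 b2 b5 b4 b1 b1).2.2
    (e₅ := corner K L m' r s + corner K L m' (r + 1) s + horEdge L m' r (s + 1) - horEdge L m' r s - verEdge K m' r s
      - verEdge K m' (r + 1) s) ?_
    (abs_six_le b1 b2 b6 b3 b4 b5).1
  · rw [f1, f2, f5]; simp only [quad]; ring
  · rw [f1, f2, f7, f8]; simp only [quad]; ring
  · rw [f1, f2, f5, f6, f7, f8]; simp only [quad]; ring

theorem cellEstimate_north (hr1 : 1 ≤ r) (hr2 : r ≤ K.N) (hs1 : 1 ≤ s) (hs2 : s ≤ L.N) :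
    CellEstimate K L (convexHull ℝ {A K L (r - 1) s, A K L r s, M K L r s})
      (K.mid r, L.x s) := by
  have hH := K.step_pos hr1 hr2
  have hH' := L.step_pos hs1 hs2
  have hHH := mul_pos hH hH'
  have ex := K.x_sub_one r
  have ey := L.x_sub_one s
  have mx := K.mid_eq_sub r
  have my := L.mid_eq_sub s
  have hrect := fun p hp => mem_openRect_of_triangle (P := A K L (r - 1) s)
    (Q := A K L r s) (p := p) hr1 hr2 hs1 hs2
    (by constructor <;> constructor <;> simp only [A] <;> linarith)
    (by constructor <;> constructor <;> simp only [A] <;> linarith) hp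
  -- Strict inequalities are needed here, because this triangle corresponds to the `else` branches
  -- of `square`; passing to the interior supplies them.
  have hdiag : ∀ p ∈ interior (convexHull ℝ {A K L (r - 1) s, A K L r s, M K L r s}),
      (p.1 - K.x (r - 1)) / K.step r < (p.2 - L.x (s - 1)) / L.step s := by
    intro p hp
    have t := lt_of_mem_interior_triangle (α := -L.step s) (β := K.step r)
      (c := -(L.step s * K.x (r - 1) - K.step r * L.x (s - 1))) hp (Or.inr hH.ne')
      (by simp only [A, ex, ey]; linarith) (by simp only [A, ex, ey]; linarith)
      (by simp only [M, mx, my, ex, ey]; linarith)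
    rw [div_lt_div_iff₀ hH hH']
    linarith
  have hdiag' : ∀ p ∈ interior (convexHull ℝ {A K L (r - 1) s, A K L r s, M K L r s}),
      1 < (p.1 - K.x (r - 1)) / K.step r + (p.2 - L.x (s - 1)) / L.step s := by
    intro p hp
    have t := lt_of_mem_interior_triangle (α := L.step s) (β := K.step r)
      (c := L.step s * K.x r + K.step r * L.x (s - 1)) hp (Or.inl hH'.ne')
      (by simp only [A, ex, ey]; linarith) (by simp only [A, ey]; linarith)
      (by simp only [M, mx, my, ey]; linarith)
    rw [div_add_div _ _ hH.ne' hH'.ne', one_lt_div (mul_pos hH hH'), ex]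
    linarith
  refine ⟨⟨K.mid_mem r, L.x_mem _⟩, fun P hP => ⟨openRect_subset K L r s (hrect P hP),
    (l1_le_of_mem_openRect (hrect P hP)).2.1⟩, fun m m' c₀ c₁ c₂ c₃ c₄ c₅ B hm hm' => ?_⟩
  have hx := step_le_hmax_left K L
  have hy := step_le_hmax_right K L
  have hh := hmax_pos K L
  -- `corner` and `horEdge` with second index q live on the line y_{q-1}, so the top side is q =
  -- s+1, and the row s of the rectangle is q-1.
  obtain ⟨b1, b2, b3, b4, b5⟩ := abs_coeffs_le_of_horizontal (s := s) (q := s + 1) hr1 hr2 (by omega)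
    (by omega) hm' (by rw [add_sub_cancel_right]; exact L.abs_mid_sub_x_le hy s)
    (L.abs_mid_succ_sub_x_le hy s) (Or.inl (by ring))
  have b6 : |horEdge L m' r s| ≤ B := Knots.abs_interp_le (by omega) (by omega)
    (hm' _ _ (l1_mid_left (L.abs_mid_pred_sub_x_le hy s)))
    (hm' _ _ (l1_mid_left ((L.abs_mid_sub_x_le hy s).trans (by linarith))))
  obtain ⟨f1, f2, f3, f4⟩ := corner_blossom hr1 hr2 hs1 hs2 hm rfl rfl rfl rfl
  obtain ⟨f5, f6⟩ := horEdge_blossom (r := r) hs1 hs2 hm rfl rfl rfl rfl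
  obtain ⟨f7, f8⟩ := verEdge_blossom (s := s) hr1 hr2 hm rfl rfl rfl rfl
  refine exists_quad_of_piece ((abs_nonneg _).trans b1) hr1 hr2 hs1 hs2
    (fun p hp => (spline_eq_square K L m hr1 hr2 hs1 hs2 (hrect p hp)).trans
      (square_north _ _ _ _ _ _ _ _ (hdiag p hp) (hdiag' p hp)))
    (e₃ := corner K L m' r (s + 1) - 2 * horEdge L m' r (s + 1) + corner K L m' (r + 1) (s + 1)) ?_
    (abs_six_le b1 b3 b2 b1 b1 b1).2.1
    (e₄ := corner K L m' (r + 1) (s + 1) - corner K L m' r (s + 1) + verEdge K m' r s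
      - verEdge K m' (r + 1) s) ?_
    (abs_six_le b2 b1 b4 b5 b1 b1).2.2
    (e₅ := corner K L m' r (s + 1) + corner K L m' (r + 1) (s + 1) + horEdge L m' r s - horEdge L m' r (s + 1) - verEdge K m' r s
      - verEdge K m' (r + 1) s) ?_
    (abs_six_le b1 b2 b6 b3 b4 b5).1
  · rw [f3, f4, f6]; simp only [quad]; ring
  · rw [f3, f4, f7, f8]; simp only [quad]; ring
  · rw [f3, f4, f5, f6, f7, f8]; simp only [quad]; ring

theorem cellEstimate_west (hr1 : 1 ≤ r) (hr2 : r ≤ K.N) (hs1 : 1 ≤ s) (hs2 : s ≤ L.N) :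
    CellEstimate K L (convexHull ℝ {A K L (r - 1) (s - 1), A K L (r - 1) s, M K L r s})
      (K.x (r - 1), L.mid s) := by
  have hH := K.step_pos hr1 hr2
  have hH' := L.step_pos hs1 hs2
  have hHH := mul_pos hH hH'
  have ex := K.x_sub_one r
  have ey := L.x_sub_one s
  have mx := K.mid_eq_sub r
  have my := L.mid_eq_sub s
  have hrect := fun p hp => mem_openRect_of_triangle (P := A K L (r - 1) (s - 1))
    (Q := A K L (r - 1) s) (p := p) hr1 hr2 hs1 hs2
    (by constructor <;> constructor <;> simp only [A] <;> linarith)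
    (by constructor <;> constructor <;> simp only [A] <;> linarith) hp
  have hdiag : ∀ p ∈ interior (convexHull ℝ {A K L (r - 1) (s - 1), A K L (r - 1) s, M K L r s}),
      (p.1 - K.x (r - 1)) / K.step r < (p.2 - L.x (s - 1)) / L.step s := by
    intro p hp
    have t := lt_of_mem_interior_triangle (α := -L.step s) (β := K.step r)
      (c := -(L.step s * K.x (r - 1) - K.step r * L.x (s - 1))) hp (Or.inr hH.ne')
      (by simp only [A, ex, ey]; linarith) (by simp only [A, ex, ey]; linarith)
      (by simp only [M, mx, my, ex, ey]; linarith)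
    rw [div_lt_div_iff₀ hH hH']
    linarith
  have hdiag' : ∀ p ∈ interior (convexHull ℝ {A K L (r - 1) (s - 1), A K L (r - 1) s, M K L r s}),
      (p.1 - K.x (r - 1)) / K.step r + (p.2 - L.x (s - 1)) / L.step s ≤ 1 := by
    intro p hp
    have t := lt_of_mem_interior_triangle (α := -L.step s) (β := -K.step r)
      (c := -(L.step s * K.x r + K.step r * L.x (s - 1))) hp (Or.inl (neg_ne_zero.2 hH'.ne'))
      (by simp only [A, ex, ey]; linarith) (by simp only [A, ex, ey]; linarith)
      (by simp only [M, mx, my, ey]; linarith)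
    rw [div_add_div _ _ hH.ne' hH'.ne', div_le_one (mul_pos hH hH'), ex]
    linarith
  refine ⟨⟨K.x_mem _, L.mid_mem s⟩, fun P hP => ⟨openRect_subset K L r s (hrect P hP),
    (l1_le_of_mem_openRect (hrect P hP)).2.2.1⟩, fun m m' c₀ c₁ c₂ c₃ c₄ c₅ B hm hm' => ?_⟩
  have hx := step_le_hmax_left K L
  have hy := step_le_hmax_right K L
  have hh := hmax_pos K L
  obtain ⟨b1, b2, b3, b4, b5⟩ := abs_coeffs_le_of_vertical (r := r) hs1 hs2 hr1 (by omega) hm'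
    (K.abs_mid_pred_sub_x_pred_le hx r) (K.abs_mid_sub_x_pred_le hx r) (Or.inr rfl)
  have b6 : |verEdge K m' (r + 1) s| ≤ B := Knots.abs_interp_le (by omega) (by omega)
    (by rw [add_sub_cancel_right]
        exact hm' _ _ (l1_mid_right ((K.abs_mid_sub_x_pred_le hx r).trans (by linarith))))
    (hm' _ _ (l1_mid_right (K.abs_mid_succ_sub_x_pred_le hx r)))
  obtain ⟨f1, f2, f3, f4⟩ := corner_blossom hr1 hr2 hs1 hs2 hm rfl rfl rfl rfl
  obtain ⟨f5, f6⟩ := horEdge_blossom (r := r) hs1 hs2 hm rfl rfl rfl rfl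
  obtain ⟨f7, f8⟩ := verEdge_blossom (s := s) hr1 hr2 hm rfl rfl rfl rfl
  refine exists_quad_of_piece ((abs_nonneg _).trans b1) hr1 hr2 hs1 hs2
    (fun p hp => (spline_eq_square K L m hr1 hr2 hs1 hs2 (hrect p hp)).trans
      (square_west _ _ _ _ _ _ _ _ (hdiag p hp) (hdiag' p hp)))
    (e₃ := corner K L m' r s + corner K L m' r (s + 1) + verEdge K m' (r + 1) s - verEdge K m' r s - horEdge L m' r s
      - horEdge L m' r (s + 1)) ?_
    (abs_six_le b1 b2 b6 b3 b4 b5).1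
    (e₄ := corner K L m' r s - corner K L m' r (s + 1) + horEdge L m' r (s + 1)
      - horEdge L m' r s) ?_
    (abs_six_le b1 b2 b5 b4 b1 b1).2.2
    (e₅ := corner K L m' r s - 2 * verEdge K m' r s + corner K L m' r (s + 1)) ?_
    (abs_six_le b1 b3 b2 b1 b1 b1).2.1
  · rw [f1, f3, f5, f6, f7, f8]; simp only [quad]; ring
  · rw [f1, f3, f5, f6]; simp only [quad]; ring
  · rw [f1, f3, f7]; simp only [quad]; ring

theorem cellEstimate_east (hr1 : 1 ≤ r) (hr2 : r ≤ K.N) (hs1 : 1 ≤ s) (hs2 : s ≤ L.N) :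
    CellEstimate K L (convexHull ℝ {A K L r (s - 1), A K L r s, M K L r s})
      (K.x r, L.mid s) := by
  have hH := K.step_pos hr1 hr2
  have hH' := L.step_pos hs1 hs2
  have hHH := mul_pos hH hH'
  have ex := K.x_sub_one r
  have ey := L.x_sub_one s
  have mx := K.mid_eq_sub r
  have my := L.mid_eq_sub s
  have hrect := fun p hp => mem_openRect_of_triangle (P := A K L r (s - 1))
    (Q := A K L r s) (p := p) hr1 hr2 hs1 hs2
    (by constructor <;> constructor <;> simp only [A] <;> linarith)
    (by constructor <;> constructor <;> simp only [A] <;> linarith) hp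
  have hdiag : ∀ p ∈ interior (convexHull ℝ {A K L r (s - 1), A K L r s, M K L r s}),
      (p.2 - L.x (s - 1)) / L.step s ≤ (p.1 - K.x (r - 1)) / K.step r := by
    intro p hp
    have t := lt_of_mem_interior_triangle (α := L.step s) (β := -K.step r)
      (c := L.step s * K.x (r - 1) - K.step r * L.x (s - 1)) hp (Or.inl hH'.ne')
      (by simp only [A, ex, ey]; linarith) (by simp only [A, ex, ey]; linarith)
      (by simp only [M, mx, my, ex, ey]; linarith)
    rw [div_le_div_iff₀ hH' hH]
    linarith
  have hdiag' : ∀ p ∈ interior (convexHull ℝ {A K L r (s - 1), A K L r s, M K L r s}),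
      1 < (p.1 - K.x (r - 1)) / K.step r + (p.2 - L.x (s - 1)) / L.step s := by
    intro p hp
    have t := lt_of_mem_interior_triangle (α := L.step s) (β := K.step r)
      (c := L.step s * K.x r + K.step r * L.x (s - 1)) hp (Or.inl hH'.ne')
      (by simp only [A, ey]; linarith) (by simp only [A, ey]; linarith)
      (by simp only [M, mx, my, ey]; linarith)
    rw [div_add_div _ _ hH.ne' hH'.ne', one_lt_div (mul_pos hH hH'), ex]
    linarith
  refine ⟨⟨K.x_mem _, L.mid_mem s⟩, fun P hP => ⟨openRect_subset K L r s (hrect P hP),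
    (l1_le_of_mem_openRect (hrect P hP)).2.2.2⟩, fun m m' c₀ c₁ c₂ c₃ c₄ c₅ B hm hm' => ?_⟩
  have hx := step_le_hmax_left K L
  have hy := step_le_hmax_right K L
  have hh := hmax_pos K L
  obtain ⟨b1, b2, b3, b4, b5⟩ := abs_coeffs_le_of_vertical (r := r) (q := r + 1) hs1 hs2 (by omega)
    (by omega) hm' (by rw [add_sub_cancel_right]; exact K.abs_mid_sub_x_le hx r)
    (K.abs_mid_succ_sub_x_le hx r) (Or.inl (by ring))
  have b6 : |verEdge K m' r s| ≤ B := Knots.abs_interp_le (by omega) (by omega)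
    (hm' _ _ (l1_mid_right (K.abs_mid_pred_sub_x_le hx r)))
    (hm' _ _ (l1_mid_right ((K.abs_mid_sub_x_le hx r).trans (by linarith))))
  obtain ⟨f1, f2, f3, f4⟩ := corner_blossom hr1 hr2 hs1 hs2 hm rfl rfl rfl rfl
  obtain ⟨f5, f6⟩ := horEdge_blossom (r := r) hs1 hs2 hm rfl rfl rfl rfl
  obtain ⟨f7, f8⟩ := verEdge_blossom (s := s) hr1 hr2 hm rfl rfl rfl rfl
  refine exists_quad_of_piece ((abs_nonneg _).trans b1) hr1 hr2 hs1 hs2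
    (fun p hp => (spline_eq_square K L m hr1 hr2 hs1 hs2 (hrect p hp)).trans
      (square_east _ _ _ _ _ _ _ _ (hdiag p hp) (hdiag' p hp)))
    (e₃ := corner K L m' (r + 1) s + corner K L m' (r + 1) (s + 1) + verEdge K m' r s - verEdge K m' (r + 1) s - horEdge L m' r s
      - horEdge L m' r (s + 1)) ?_
    (abs_six_le b1 b2 b6 b3 b4 b5).1
    (e₄ := corner K L m' (r + 1) (s + 1) - corner K L m' (r + 1) s + horEdge L m' r s
      - horEdge L m' r (s + 1)) ?_
    (abs_six_le b2 b1 b4 b5 b1 b1).2.2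
    (e₅ := corner K L m' (r + 1) s - 2 * verEdge K m' (r + 1) s + corner K L m' (r + 1) (s + 1)) ?_
    (abs_six_le b1 b3 b2 b1 b1 b1).2.1
  · rw [f2, f4, f5, f6, f7, f8]; simp only [quad]; ring
  · rw [f2, f4, f5, f6]; simp only [quad]; ring
  · rw [f2, f4, f8]; simp only [quad]; ring

theorem exists_cellEstimate {T : Set (ℝ × ℝ)} (hT : T ∈ cells K L) : ∃ E, CellEstimate K L T E := by
  obtain ⟨r, s, hr1, hr2, hs1, hs2, rfl | rfl | rfl | rfl⟩ := hT
  · exact ⟨_, cellEstimate_south hr1 hr2 hs1 hs2⟩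
  · exact ⟨_, cellEstimate_north hr1 hr2 hs1 hs2⟩
  · exact ⟨_, cellEstimate_west hr1 hr2 hs1 hs2⟩
  · exact ⟨_, cellEstimate_east hr1 hr2 hs1 hs2⟩

end

/-! ### Derivatives within Ω, the general error bound, and the two smoothness classes. -/

section

variable {K L : Knots}

/-! ### Partial derivatives -/

theorem contDiffOn_partialD {S : Set (ℝ × ℝ)} (hS : UniqueDiffOn ℝ S) {g : ℝ × ℝ → ℝ} {n k : ℕ}
    (hg : ContDiffOn ℝ n g S) (hk : k + 1 ≤ n) (v : ℝ × ℝ) :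
    ContDiffOn ℝ k (partialD S v g) S :=
  (hg.fderivWithin hS (by exact_mod_cast hk)).clm_apply contDiffOn_const

theorem hasFDerivWithinAt_partialD {S : Set (ℝ × ℝ)} {g : ℝ × ℝ → ℝ} {n : ℕ}
    (hg : ContDiffOn ℝ n g S) (hn : 1 ≤ n) {p : ℝ × ℝ} (hp : p ∈ S) :
    HasFDerivWithinAt g (lin (partialD S (1, 0) g p) (partialD S (0, 1) g p)) S p := by
  have := ((hg.differentiableOn (by exact_mod_cast (by omega : n ≠ 0))) p hp).hasFDerivWithinAt
  rwa [eq_lin (fderivWithin ℝ g S p)] at this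

/-- Second derivatives within S are symmetric also at boundary points, since these are limits of
interior points. -/
theorem partialD_comm {S : Set (ℝ × ℝ)} (hS : UniqueDiffOn ℝ S) (hS' : S ⊆ closure (interior S))
    {g : ℝ × ℝ → ℝ} {n : ℕ} (hg : ContDiffOn ℝ n g S) (hn : 2 ≤ n) (v w : ℝ × ℝ) :
    EqOn (partialD S v (partialD S w g)) (partialD S w (partialD S v g)) S := by
  intro p hp
  have hd : DifferentiableWithinAt ℝ (fderivWithin ℝ g S) S p :=
    ((hg.fderivWithin hS (m := 1) (by exact_mod_cast hn)).differentiableOn (by simp)) p hp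
  have key : ∀ v w : ℝ × ℝ, partialD S v (partialD S w g) p
      = fderivWithin ℝ (fderivWithin ℝ g S) S p v w := by
    intro v w
    change fderivWithin ℝ (fun y => (fderivWithin ℝ g S y) w) S p v = _
    rw [fderivWithin_clm_apply (hS p hp) hd (differentiableWithinAt_const _)]
    simp
  rw [key, key]
  exact ((hg p hp).isSymmSndFDerivWithinAt (by simpa using (by exact_mod_cast hn)) hS (hS' hp)
    hp).eq v w

theorem partialD_congr {S : Set (ℝ × ℝ)} {g g' : ℝ × ℝ → ℝ} (h : EqOn g g' S) (v : ℝ × ℝ) :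
    EqOn (partialD S v g) (partialD S v g') S := fun p hp => by
  simp only [partialD]
  rw [fderivWithin_congr h (h hp)]

theorem interior_Omega_nonempty (K L : Knots) : (interior (Omega K L)).Nonempty := by
  have hK : K.x 0 < K.x K.N := K.x_lt (by exact_mod_cast K.pos) (by exact_mod_cast K.pos)
    (by exact_mod_cast K.pos)
  have hL : L.x 0 < L.x L.N := L.x_lt (by exact_mod_cast L.pos) (by exact_mod_cast L.pos)
    (by exact_mod_cast L.pos)
  rw [Omega, interior_prod_eq, Knots.interval, Knots.interval, interior_Icc, interior_Icc]
  exact (nonempty_Ioo.2 hK).prod (nonempty_Ioo.2 hL)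

theorem uniqueDiffOn_Omega (K L : Knots) : UniqueDiffOn ℝ (Omega K L) :=
  uniqueDiffOn_convex (convex_Omega K L) (interior_Omega_nonempty K L)

theorem Omega_subset_closure (K L : Knots) : Omega K L ⊆ closure (interior (Omega K L)) :=
  ((convex_Omega K L).closure_interior_eq_closure_of_nonempty_interior
    (interior_Omega_nonempty K L)).symm ▸ subset_closure

theorem isCompact_Omega (K L : Knots) : IsCompact (Omega K L) := isCompact_Icc.prod isCompact_Icc

theorem hasJet_of_contDiffOn {f : ℝ × ℝ → ℝ} (hf : ContDiffOn ℝ 2 f (Omega K L)) :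
    HasJet (Omega K L) f (partialD (Omega K L) (1, 0) f) (partialD (Omega K L) (0, 1) f)
      (D (Omega K L) (2, 0) f) (D (Omega K L) (1, 1) f) (D (Omega K L) (0, 2) f) := by
  have hU := uniqueDiffOn_Omega K L
  have hf' : ContDiffOn ℝ (2 : ℕ) f (Omega K L) := hf
  intro p hp
  have hc := partialD_comm hU (Omega_subset_closure K L) hf' le_rfl (0, 1) (1, 0) hp
  refine ⟨hasFDerivWithinAt_partialD hf' (by norm_num) hp, ?_, ?_⟩
  · have := hasFDerivWithinAt_partialD (contDiffOn_partialD hU hf' (k := 1) le_rfl (1, 0)) le_rfl hp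
    rwa [hc] at this
  · exact hasFDerivWithinAt_partialD (contDiffOn_partialD hU hf' (k := 1) le_rfl (0, 1)) le_rfl hp

theorem partialD_quad {U : Set (ℝ × ℝ)} (hU : IsOpen U) {g : ℝ × ℝ → ℝ} {c₀ c₁ c₂ c₃ c₄ c₅ : ℝ}
    (hg : EqOn g (quad c₀ c₁ c₂ c₃ c₄ c₅) U) :
    EqOn (partialD U (1, 0) g) (quad c₁ (2 * c₃) c₄ 0 0 0) U ∧
    EqOn (partialD U (0, 1) g) (quad c₂ c₄ (2 * c₅) 0 0 0) U := by
  have key : ∀ p ∈ U, ∀ v, partialD U v g p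
      = lin (quad c₁ (2 * c₃) c₄ 0 0 0 p) (quad c₂ c₄ (2 * c₅) 0 0 0 p) v := fun p hp v => by
    rw [partialD_congr hg v hp, partialD, fderivWithin_of_isOpen hU hp,
      (hasFDerivAt_quad c₀ c₁ c₂ c₃ c₄ c₅ p).fderiv]
  exact ⟨fun p hp => by simp [key p hp], fun p hp => by simp [key p hp]⟩

theorem contDiff_quad (c₀ c₁ c₂ c₃ c₄ c₅ : ℝ) : ContDiff ℝ 2 (quad c₀ c₁ c₂ c₃ c₄ c₅) := by
  unfold quad
  fun_prop

theorem secondDerivError_of_eqOn_quad {T : Set (ℝ × ℝ)} {f g : ℝ × ℝ → ℝ} {C : ℝ}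
    {c₀ c₁ c₂ c₃ c₄ c₅ : ℝ} (hg : EqOn g (quad c₀ c₁ c₂ c₃ c₄ c₅) (interior T))
    (hxx : ∀ P ∈ interior T, |D (Omega K L) (2, 0) f P - 2 * c₃| ≤ C)
    (hxy : ∀ P ∈ interior T, |D (Omega K L) (1, 1) f P - c₄| ≤ C)
    (hyy : ∀ P ∈ interior T, |D (Omega K L) (0, 2) f P - 2 * c₅| ≤ C) {α : ℕ × ℕ}
    (hα : α.1 + α.2 = 2) : SecondDerivError K L f g T α C := by
  refine ⟨(contDiff_quad c₀ c₁ c₂ c₃ c₄ c₅).contDiffOn.congr hg, fun P hP => ?_⟩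
  have hx := partialD_quad isOpen_interior hg
  obtain ⟨i, j⟩ := α
  obtain ⟨rfl, rfl⟩ | ⟨rfl, rfl⟩ | ⟨rfl, rfl⟩ :
    (i = 2 ∧ j = 0) ∨ (i = 1 ∧ j = 1) ∨ (i = 0 ∧ j = 2) := by dsimp only at hα; omega
  · have : D (interior T) (2, 0) g P = 2 * c₃ := by
      have := (partialD_quad isOpen_interior hx.1).1 hP
      simpa [D, quad] using this
    rw [this]; exact hxx P hP
  · have : D (interior T) (1, 1) g P = c₄ := by
      have := (partialD_quad isOpen_interior hx.2).1 hP
      simpa [D, quad] using this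
    rw [this]; exact hxy P hP
  · have : D (interior T) (0, 2) g P = 2 * c₅ := by
      have := (partialD_quad isOpen_interior hx.2).2 hP
      simpa [D, quad] using this
    rw [this]; exact hyy P hP

/-! ### Error of a quasi-interpolant in terms of the variation of the second derivatives -/

/-- The properties of the coefficient functionals that the error estimates use. -/
structure IsCoeffFunctional (ν : Knots → Knots → (ℝ × ℝ → ℝ) → ℤ → ℤ → ℝ) : Prop where
  add : ∀ K L f g i j, ν K L (fun p => f p + g p) i j = ν K L f i j + ν K L g i j
  quad : ∀ K L c₀ c₁ c₂ c₃ c₄ c₅ i j,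
    ν K L (quad c₀ c₁ c₂ c₃ c₄ c₅) i j = blossom K L c₀ c₁ c₂ c₃ c₄ c₅ i j
  bound : ∀ {K L : Knots} {g gx gy gxx gxy gyy : ℝ × ℝ → ℝ} {E : ℝ × ℝ} {a b : ℝ} {i j : ℤ},
    0 ≤ a → 0 ≤ b → HasJet (Omega K L) g gx gy gxx gxy gyy →
    (∀ P ∈ Omega K L, |gxx P| ≤ a + b * l1 P E) → (∀ P ∈ Omega K L, |gyy P| ≤ a + b * l1 P E) →
    (∀ P ∈ Omega K L, |g P| ≤ l1 P E ^ 2 * (a / 2 + b * l1 P E / 6)) →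
    l1 (M K L i j) E ≤ 3 / 2 * hmax K L →
    |ν K L g i j| ≤ hmax K L ^ 2 * (11 / 8 * a + 19 / 16 * (b * hmax K L))

theorem isCoeffFunctional_mu : IsCoeffFunctional mu :=
  ⟨mu_add, mu_quad, abs_mu_le⟩

theorem isCoeffFunctional_muStar : IsCoeffFunctional muStar :=
  ⟨muStar_add, muStar_quad, abs_muStar_le⟩

/-- The error at P is split at E. The variation of the second derivative of f from P to E is at most
a + 3bh/2; the rest is the cell estimate applied to the Taylor remainder. -/
theorem IsCoeffFunctional.secondDerivError {ν : Knots → Knots → (ℝ × ℝ → ℝ) → ℤ → ℤ → ℝ}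
    (hν : IsCoeffFunctional ν) {f : ℝ × ℝ → ℝ} (hf : ContDiffOn ℝ 2 f (Omega K L)) {a b : ℝ}
    (ha : 0 ≤ a) (hb : 0 ≤ b)
    (hD : ∀ α : ℕ × ℕ, α.1 + α.2 = 2 → ∀ P ∈ Omega K L, ∀ Q ∈ Omega K L,
      |D (Omega K L) α f P - D (Omega K L) α f Q| ≤ a + b * l1 P Q)
    {T : Set (ℝ × ℝ)} (hT : T ∈ cells K L) {α : ℕ × ℕ} (hα : α.1 + α.2 = 2) :
    SecondDerivError K L f (spline K L (ν K L f)) T α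
      (a + 3 / 2 * (b * hmax K L)
        + 12 * (11 / 8 * a + 19 / 16 * (b * hmax K L)) * (hmax K L / hmin K L) ^ 2) := by
  obtain ⟨E, hE, hTE, hest⟩ := exists_cellEstimate hT
  obtain ⟨c₀, c₁, c₂, g, gx, gy, gxx, gxy, gyy, hjet, hfg, h1, h2, h3⟩ :=
    (hasJet_of_contDiffOn hf).exists_taylor_remainder (convex_Omega K L) hE
      (fun P hP => hD (2, 0) rfl P hP E hE) (fun P hP => hD (1, 1) rfl P hP E hE)
      (fun P hP => hD (0, 2) rfl P hP E hE)
  have hsum : ∀ i j, ν K L f i j = blossom K L c₀ c₁ c₂ (D (Omega K L) (2, 0) f E / 2)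
      (D (Omega K L) (1, 1) f E) (D (Omega K L) (0, 2) f E / 2) i j + ν K L g i j := by
    intro i j
    rw [← hν.quad, ← hν.add]
    congr 1
    -- The splitting of f holds on the whole plane, so it is an equality of functions and additivity
    -- applies directly.
    exact funext hfg
  obtain ⟨d₀, d₁, d₂, d₃, d₄, d₅, hq, e3, e4, e5⟩ := hest _ _ _ _ _ _ _ _ _ hsum
    (fun i j hij => hν.bound ha hb hjet h1 h2 h3 hij)
  have hδ := hmin_pos K L
  have key : ∀ α : ℕ × ℕ, α.1 + α.2 = 2 → ∀ c, |D (Omega K L) α f E - c| ≤ 12 * (hmax K L ^ 2 *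
      (11 / 8 * a + 19 / 16 * (b * hmax K L))) / hmin K L ^ 2 → ∀ P ∈ interior T,
      |D (Omega K L) α f P - c| ≤ a + 3 / 2 * (b * hmax K L)
        + 12 * (11 / 8 * a + 19 / 16 * (b * hmax K L)) * (hmax K L / hmin K L) ^ 2 := by
    intro α hα c hc P hP
    have k1 := hD α hα P (hTE P hP).1 E hE
    have k2 := mul_le_mul_of_nonneg_left (hTE P hP).2 hb
    have k3 := abs_add_le (D (Omega K L) α f P - D (Omega K L) α f E) (D (Omega K L) α f E - c)
    rw [sub_add_sub_cancel] at k3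
    have k4 : 12 * (hmax K L ^ 2 * (11 / 8 * a + 19 / 16 * (b * hmax K L))) / hmin K L ^ 2
        = 12 * (11 / 8 * a + 19 / 16 * (b * hmax K L)) * (hmax K L / hmin K L) ^ 2 := by
      rw [div_pow]; ring
    linarith
  refine secondDerivError_of_eqOn_quad hq (key _ rfl _ ?_) (key _ rfl _ e4) (key _ rfl _ ?_) hα
  · rwa [mul_div_cancel₀ _ two_ne_zero] at e3
  · rwa [mul_div_cancel₀ _ two_ne_zero] at e5

/-! ### Moduli of continuity -/

theorem eucDist_le_l1 (P Q : ℝ × ℝ) : eucDist P Q ≤ l1 P Q := by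
  rw [eucDist, l1]
  apply Real.sqrt_le_iff.2 ⟨by positivity, ?_⟩
  rw [add_sq, sq_abs, sq_abs]
  nlinarith [mul_nonneg (abs_nonneg (P.1 - Q.1)) (abs_nonneg (P.2 - Q.2))]

theorem eucDist_of_smul {P Q P' Q' : ℝ × ℝ} {c : ℝ} (hc : 0 ≤ c) (h : P' - Q' = c • (P - Q)) :
    eucDist P' Q' = c * eucDist P Q := by
  have h1 : P'.1 - Q'.1 = c * (P.1 - Q.1) := congrArg Prod.fst h
  have h2 : P'.2 - Q'.2 = c * (P.2 - Q.2) := congrArg Prod.snd h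
  rw [eucDist, eucDist, h1, h2, mul_pow, mul_pow, ← mul_add, Real.sqrt_mul (sq_nonneg c),
    Real.sqrt_sq hc]

/-- Induction cuts the segment into n+1 equal pieces of length at most t; convexity keeps the
division points in S. -/
theorem abs_sub_le_nat_mul_modulus {S : Set (ℝ × ℝ)} (hS : Convex ℝ S) {ψ : ℝ × ℝ → ℝ} {t ω : ℝ}
    (hψ : ∀ P ∈ S, ∀ Q ∈ S, eucDist P Q ≤ t → |ψ P - ψ Q| ≤ ω) (n : ℕ) :
    ∀ P ∈ S, ∀ Q ∈ S, eucDist P Q ≤ (n + 1) * t → |ψ P - ψ Q| ≤ (n + 1) * ω := by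
  induction n with
  | zero => simpa using hψ
  | succ n ih =>
    intro P hP Q hQ h
    push_cast at h ⊢
    have hn : (0 : ℝ) < n + 1 + 1 := by positivity
    have hc : (0 : ℝ) ≤ 1 / (n + 1 + 1) := by positivity
    have hc1 : (1 : ℝ) / (n + 1 + 1) ≤ 1 := by
      rw [div_le_one hn]; linarith [Nat.cast_nonneg (α := ℝ) n]
    set c : ℝ := 1 / (n + 1 + 1) with hcdef
    have hcn : c * (n + 1 + 1) = 1 := by rw [hcdef]; field_simp
    have hR : P + c • (Q - P) ∈ S := hS.add_smul_sub_mem hP hQ ⟨hc, hc1⟩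
    have h1 : eucDist P (P + c • (Q - P)) ≤ t := by
      rw [eucDist_of_smul (P := P) (Q := Q) hc (by module)]
      calc c * eucDist P Q ≤ c * ((n + 1 + 1) * t) := by gcongr
        _ = t := by rw [← mul_assoc, hcn, one_mul]
    have h2 : eucDist (P + c • (Q - P)) Q ≤ (n + 1) * t := by
      rw [eucDist_of_smul (P := P) (Q := Q) (c := 1 - c) (by linarith) (by module)]
      calc (1 - c) * eucDist P Q ≤ (1 - c) * ((n + 1 + 1) * t) := by
            gcongr
        _ = (n + 1) * t := by linear_combination (-t) * hcn
    have h3 := hψ _ hP _ hR h1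
    have h4 := ih _ hR _ hQ h2
    have h5 := abs_add_le (ψ P - ψ (P + c • (Q - P))) (ψ (P + c • (Q - P)) - ψ Q)
    rw [sub_add_sub_cancel] at h5
    linarith

/-- Compactness bounds the set of differences, so that `sSup` is a genuine supremum rather than a
default value. -/
theorem abs_sub_le_modulus {S : Set (ℝ × ℝ)} (hS : IsCompact S) {ψ : ℝ × ℝ → ℝ}
    (hψ : ContinuousOn ψ S) {t : ℝ} {P Q : ℝ × ℝ} (hP : P ∈ S) (hQ : Q ∈ S)
    (h : eucDist P Q ≤ t) : |ψ P - ψ Q| ≤ modulus S ψ t := by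
  obtain ⟨C, hC⟩ := hS.exists_bound_of_continuousOn hψ
  refine le_csSup ⟨C + C, ?_⟩ ⟨P, hP, Q, hQ, h, rfl⟩
  rintro _ ⟨P, hP, Q, hQ, _, rfl⟩
  exact (abs_sub _ _).trans (add_le_add (hC P hP) (hC Q hQ))

theorem contDiffOn_D {f : ℝ × ℝ → ℝ} {n : ℕ} (hf : ContDiffOn ℝ n f (Omega K L)) :
    ∀ α : ℕ × ℕ, α.1 + α.2 ≤ n → ContDiffOn ℝ (n - (α.1 + α.2) : ℕ) (D (Omega K L) α f) (Omega K L) := by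
  have hU := uniqueDiffOn_Omega K L
  have iter : ∀ (v : ℝ × ℝ) (k N : ℕ) (g : ℝ × ℝ → ℝ), ContDiffOn ℝ N g (Omega K L) → k ≤ N →
      ContDiffOn ℝ (N - k : ℕ) ((partialD (Omega K L) v)^[k] g) (Omega K L) := by
    intro v k
    induction k with
    | zero => intro N g hg _; simpa using hg
    | succ k ih =>
      intro N g hg hk
      rw [Function.iterate_succ_apply']
      exact contDiffOn_partialD hU (ih N g hg (by omega)) (by omega) v
  intro α hα
  have := iter (1, 0) α.1 _ _ (iter (0, 1) α.2 n f hf (by omega)) (by omega)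
  rwa [show n - α.2 - α.1 = n - (α.1 + α.2) by omega] at this

theorem abs_D_sub_le_of_contDiffOn_two {f : ℝ × ℝ → ℝ} (hf : ContDiffOn ℝ 2 f (Omega K L))
    {t : ℝ} (ht : 0 < t) :
    0 ≤ modulusD (Omega K L) 2 f t ∧
    ∀ α : ℕ × ℕ, α.1 + α.2 = 2 → ∀ P ∈ Omega K L, ∀ Q ∈ Omega K L,
      |D (Omega K L) α f P - D (Omega K L) α f Q|
        ≤ modulusD (Omega K L) 2 f t + modulusD (Omega K L) 2 f t / t * l1 P Q := by
  have hf' : ContDiffOn ℝ (2 : ℕ) f (Omega K L) := hf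
  set ω := modulusD (Omega K L) 2 f t
  have hstep : ∀ α : ℕ × ℕ, α.1 + α.2 = 2 → ∀ P ∈ Omega K L, ∀ Q ∈ Omega K L, eucDist P Q ≤ t →
      |D (Omega K L) α f P - D (Omega K L) α f Q| ≤ ω := by
    intro α hα P hP Q hQ h
    refine (abs_sub_le_modulus (isCompact_Omega K L)
      (contDiffOn_D hf' α hα.le).continuousOn hP hQ h).trans ?_
    exact Finset.le_sup' (fun α => modulus (Omega K L) (D (Omega K L) α f) t)
      (Finset.HasAntidiagonal.mem_antidiagonal.2 hα)
  have hω : 0 ≤ ω := by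
    have hm := M_mem (K := K) (L := L) 0 0
    refine (abs_nonneg _).trans (hstep (2, 0) rfl _ hm _ hm ?_)
    simp [eucDist, ht.le]
  refine ⟨hω, fun α hα P hP Q hQ => ?_⟩
  have h0 : 0 ≤ l1 P Q := by unfold l1; positivity
  -- With n = ⌊ℓ¹/t⌋ the distance is below (n+1)t, and n+1 ≤ 1 + ℓ¹/t gives the affine bound.
  refine (abs_sub_le_nat_mul_modulus (convex_Omega K L) (hstep α hα) ⌊l1 P Q / t⌋₊ P hP Q hQ
    ?_).trans ?_
  · have := Nat.lt_floor_add_one (l1 P Q / t)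
    rw [div_lt_iff₀ ht] at this
    exact (eucDist_le_l1 P Q).trans this.le
  · have := Nat.floor_le (div_nonneg h0 ht.le)
    calc (⌊l1 P Q / t⌋₊ + 1) * ω ≤ (l1 P Q / t + 1) * ω := by gcongr
      _ = ω + ω / t * l1 P Q := by ring

theorem abs_D_sub_le_of_contDiffOn_three {f : ℝ × ℝ → ℝ} (hf : ContDiffOn ℝ 3 f (Omega K L)) :
    0 ≤ normD (Omega K L) 3 f ∧
    ∀ α : ℕ × ℕ, α.1 + α.2 = 2 → ∀ P ∈ Omega K L, ∀ Q ∈ Omega K L,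
      |D (Omega K L) α f P - D (Omega K L) α f Q| ≤ normD (Omega K L) 3 f * l1 P Q := by
  have hf' : ContDiffOn ℝ (3 : ℕ) f (Omega K L) := hf
  have hU := uniqueDiffOn_Omega K L
  have hcl := Omega_subset_closure K L
  set N := normD (Omega K L) 3 f
  have hN : ∀ α : ℕ × ℕ, α.1 + α.2 = 3 → ∀ P ∈ Omega K L, |D (Omega K L) α f P| ≤ N := by
    intro α hα P hP
    obtain ⟨C, hC⟩ := (isCompact_Omega K L).exists_bound_of_continuousOn
      (contDiffOn_D hf' α hα.le).continuousOn
    have h1 : |D (Omega K L) α f P| ≤ supNorm (Omega K L) (D (Omega K L) α f) := by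
      refine le_csSup ⟨C, ?_⟩ ⟨P, hP, rfl⟩
      rintro _ ⟨Q, hQ, rfl⟩
      exact hC Q hQ
    exact h1.trans (Finset.le_sup' (fun α => supNorm (Omega K L) (D (Omega K L) α f))
      (Finset.HasAntidiagonal.mem_antidiagonal.2 hα))
  refine ⟨(abs_nonneg _).trans (hN (3, 0) rfl _ (M_mem 0 0)), fun α hα P hP Q hQ => ?_⟩
  have hfx := contDiffOn_partialD hU hf' (k := 2) le_rfl (1, 0)
  have hfy := contDiffOn_partialD hU hf' (k := 2) le_rfl (0, 1)
  have hcomm := partialD_comm hU hcl hf' (by norm_num) (0, 1) (1, 0)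
  refine abs_sub_le_of_partials_le (convex_Omega K L)
    (fun p hp => hasFDerivWithinAt_partialD (contDiffOn_D hf' α (by omega)) (by omega) hp)
    ?_ ?_ hP hQ
  -- `D` applies the y-derivatives first. The x-derivative of a second derivative is thus already
  -- some D^α with |α| = 3, whereas an outer y-derivative must be commuted inwards.
  all_goals
    intro p hp
    obtain ⟨i, j⟩ := α
    obtain ⟨rfl, rfl⟩ | ⟨rfl, rfl⟩ | ⟨rfl, rfl⟩ :
      (i = 2 ∧ j = 0) ∨ (i = 1 ∧ j = 1) ∨ (i = 0 ∧ j = 2) := by dsimp only at hα; omega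
  · exact hN (3, 0) rfl p hp
  · exact hN (2, 1) rfl p hp
  · exact hN (1, 2) rfl p hp
  · have h1 := partialD_comm hU hcl hfx le_rfl (0, 1) (1, 0) hp
    have h2 := partialD_congr hcomm (1, 0) hp
    have h3 := hN (2, 1) rfl p hp
    exact (h1.trans h2) ▸ h3
  · have h1 := partialD_comm hU hcl hfy le_rfl (0, 1) (1, 0) hp
    have h3 := hN (1, 2) rfl p hp
    exact h1 ▸ h3
  · exact hN (0, 3) rfl p hp

theorem SecondDerivError.mono {f g : ℝ × ℝ → ℝ} {T : Set (ℝ × ℝ)} {α : ℕ × ℕ} {C C' : ℝ}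
    (h : SecondDerivError K L f g T α C) (hC : C ≤ C') : SecondDerivError K L f g T α C' :=
  ⟨h.1, fun P hP => (h.2 P hP).trans hC⟩

theorem one_le_ratio_sq (K L : Knots) : 1 ≤ (hmax K L / hmin K L) ^ 2 :=
  one_le_pow₀ ((one_le_div (hmin_pos K L)).2 (hmin_le_hmax K L))

/-- With a = ω and b = 2ω/h the bound is 4ω + 45ω(h/δ)². Since h ≥ δ, the excess 3ω is absorbed,
giving 45 + 3 = 48. -/
theorem IsCoeffFunctional.secondDerivError_two {ν : Knots → Knots → (ℝ × ℝ → ℝ) → ℤ → ℤ → ℝ}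
    (hν : IsCoeffFunctional ν) {f : ℝ × ℝ → ℝ} (hf : ContDiffOn ℝ 2 f (Omega K L))
    {T : Set (ℝ × ℝ)} (hT : T ∈ cells K L) {α : ℕ × ℕ} (hα : α.1 + α.2 = 2) :
    SecondDerivError K L f (spline K L (ν K L f)) T α
      ((1 + 48 * (hmax K L / hmin K L) ^ 2) * modulusD (Omega K L) 2 f (hmax K L / 2)) := by
  have hh := hmax_pos K L
  obtain ⟨hω, hD⟩ := abs_D_sub_le_of_contDiffOn_two hf (half_pos hh)
  set ω := modulusD (Omega K L) 2 f (hmax K L / 2)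
  refine (hν.secondDerivError hf hω (by positivity) hD hT hα).mono ?_
  have e : ω / (hmax K L / 2) * hmax K L = 2 * ω := by field_simp
  rw [e]
  nlinarith [mul_le_mul_of_nonneg_left (one_le_ratio_sq K L) hω]

/-- With a = 0 and b = ‖D³f‖ the bound is (3/2 + (57/4)(h/δ)²) h‖D³f‖. The excess 1/2 is absorbed,
giving 59/4. -/
theorem IsCoeffFunctional.secondDerivError_three {ν : Knots → Knots → (ℝ × ℝ → ℝ) → ℤ → ℤ → ℝ}
    (hν : IsCoeffFunctional ν) {f : ℝ × ℝ → ℝ} (hf : ContDiffOn ℝ 3 f (Omega K L))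
    {T : Set (ℝ × ℝ)} (hT : T ∈ cells K L) {α : ℕ × ℕ} (hα : α.1 + α.2 = 2) :
    SecondDerivError K L f (spline K L (ν K L f)) T α
      ((1 + 59 / 4 * (hmax K L / hmin K L) ^ 2) * hmax K L * normD (Omega K L) 3 f) := by
  have hh := hmax_pos K L
  obtain ⟨hN, hD⟩ := abs_D_sub_le_of_contDiffOn_three hf
  refine (hν.secondDerivError (hf.of_le (by norm_num)) le_rfl hN
    (fun α hα P hP Q hQ => by rw [zero_add]; exact hD α hα P hP Q hQ) hT hα).mono ?_
  nlinarith [mul_le_mul_of_nonneg_left (one_le_ratio_sq K L) (mul_nonneg hN hh.le)]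

end

end

end CrissCross

theorem theorem6 :
    -- `C²` functions, the operator `S_2`
    (∃ D₂ : ℝ, 0 < D₂ ∧ D₂ ≤ 183 ∧
      ∀ (K L : Knots) (f : ℝ × ℝ → ℝ), ContDiffOn ℝ 2 f (Omega K L) →
        ∀ T ∈ cells K L, ∀ α : ℕ × ℕ, α.1 + α.2 = 2 →
          SecondDerivError K L f (S2 K L f) T α
            ((1 + D₂ * (hmax K L / hmin K L) ^ 2) *
              modulusD (Omega K L) 2 f (hmax K L / 2))) ∧
    -- `C²` functions, the operator `W_2^*`
    (∃ D₂ : ℝ, 0 < D₂ ∧ D₂ ≤ 195 / 2 ∧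
      ∀ (K L : Knots) (f : ℝ × ℝ → ℝ), ContDiffOn ℝ 2 f (Omega K L) →
        ∀ T ∈ cells K L, ∀ α : ℕ × ℕ, α.1 + α.2 = 2 →
          SecondDerivError K L f (W2star K L f) T α
            ((1 + D₂ * (hmax K L / hmin K L) ^ 2) *
              modulusD (Omega K L) 2 f (hmax K L / 2))) ∧
    -- `C³` functions, the operator `S_2`
    (∃ D₃ : ℝ, 0 < D₃ ∧ D₃ ≤ 269 / 8 ∧
      ∀ (K L : Knots) (f : ℝ × ℝ → ℝ), ContDiffOn ℝ 3 f (Omega K L) →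
        ∀ T ∈ cells K L, ∀ α : ℕ × ℕ, α.1 + α.2 = 2 →
          SecondDerivError K L f (S2 K L f) T α
            ((1 + D₃ * (hmax K L / hmin K L) ^ 2) * hmax K L *
              normD (Omega K L) 3 f)) ∧
    -- `C³` functions, the operator `W_2^*`
    (∃ D₃ : ℝ, 0 < D₃ ∧ D₃ ≤ 65 / 4 ∧
      ∀ (K L : Knots) (f : ℝ × ℝ → ℝ), ContDiffOn ℝ 3 f (Omega K L) →
        ∀ T ∈ cells K L, ∀ α : ℕ × ℕ, α.1 + α.2 = 2 →
          SecondDerivError K L f (W2star K L f) T α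
            ((1 + D₃ * (hmax K L / hmin K L) ^ 2) * hmax K L *
              normD (Omega K L) 3 f)) := by
  -- `S2` and `W2star` unfold to `spline` with coefficients `mu` and `muStar`, so one constant per
  -- smoothness class serves both.
  exact ⟨⟨48, by norm_num, by norm_num, fun _ _ _ hf _ hT _ hα =>
      isCoeffFunctional_mu.secondDerivError_two hf hT hα⟩,
    ⟨48, by norm_num, by norm_num, fun _ _ _ hf _ hT _ hα =>
      isCoeffFunctional_muStar.secondDerivError_two hf hT hα⟩,
    ⟨59 / 4, by norm_num, by norm_num, fun _ _ _ hf _ hT _ hα =>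
      isCoeffFunctional_mu.secondDerivError_three hf hT hα⟩,
    ⟨59 / 4, by norm_num, by norm_num, fun _ _ _ hf _ hT _ hα =>
      isCoeffFunctional_muStar.secondDerivError_three hf hT hα⟩⟩
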